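/- Let $n\ge 2$ and write $\overline{\mathbb R^n}=\mathbb R^n\cup\{\infty\}$, with the chordal metric $h(x,y)=\frac{|x-y|}{\sqrt{1+|x|^2}\sqrt{1+|y|^2}}$, $h(x,\infty)=\frac1{\sqrt{1+|x|^2}}$ for $x,y\in\mathbb R^n$; for sets put $h(A,B)=\inf_{x\in A,\,y\in B}h(x,y)$ (with $\inf\varnothing=\infty$). A domain is a nonempty open connected subset of $\mathbb R^n$, and the boundary $\partial D$ of a domain $D$ is taken in $\overline{\mathbb R^n}$. Put $S(y_0,r)=\{y\in\mathbb R^n:|y-y_0|=r\}$ and $A(y_0,r_1,r_2)=\{y\in\mathbb R^n:r_1<|y-y_0|<r_2\}$. For a family $\Gamma$ of paths in $\mathbb R^n$, let $M(\Gamma)=\inf_\rho\int_{\mathbb R^n}\rho^n\,dm$ be its conformal modulus, the infimum being over all Borel $\rho:\mathbb R^n\to[0,\infty]$ with $\int_\gamma\rho\,|dx|\ge1$ for every locally rectifiable $\gamma\in\Gamma$. For a domain $D$ and $f:D\to\mathbb R^n$, let $\Gamma_f(y_0,r_1,r_2)$ be the family of all paths $\gamma:[a,b]\to D$ with $f(\gamma(a))\in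 S(y_0,r_1)$, $f(\gamma(b))\in S(y_0,r_2)$ and $f(\gamma(t))\in A(y_0,r_1,r_2)$ for $t\in(a,b)$. Let $\delta>0$, let $D,D_0\subset\mathbb R^n$ be domains, let $E\subset D_0$ be a nonempty compact set, and let $Q:\mathbb R^n\to[0,\infty]$ be a Lebesgue measurable function that vanishes outside $D_0$. Let $\mathfrak F^E_{Q,\delta}(D,D_0)$ be the class of all continuous, open, discrete mappings $f:D\to D_0$ of $D$ onto a domain $f(D)$ with $E\subset f(D)\subset D_0$ that are closed as mappings onto $f(D)$, satisfy $h(f^{-1}(E),\partial D)\ge\delta$, and satisfy $$M(\Gamma_f(y_0,r_1,r_2))\le\int_{A(y_0,r_1,r_2)\cap f(D)}Q(y)\,\eta^n(|y-y_0|)\,dm(y)$$ for every $y_0\in\overline{D_0}$ (closure in $\mathbb R^n$), all $0<r_1<r_2<\sup_{y\in f(D)}|y-y_0|$ and every Lebesgue measurable $\eta:(r_1,r_2)\to[0,\infty]$ with $\int_{r_1}^{r_2}\eta(r)\,dr\ge1$. Let $f_m\in\mathfrak F^E_{Q,\delta}(D,D_0)$, $m=1,2,\ldots$. Assume: (1)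 no connected component of $\partial D$ is a single point; (2) the domains $f_m(D)$ converge to $D_0$ as their kernel with respect to some point $A_0$; that is, some ball centred at $A_0$ lies in all $f_m(D)$, and for every subsequence $f_{m_k}(D)$, $D_0$ is the largest domain $G$ containing $A_0$ such that each compact subset of $G$ lies in $f_{m_k}(D)$ for all sufficiently large $k$; (3) for every $y_0\in\overline{D_0}$ (closure in $\mathbb R^n$) and all $0<r_1<r_2<\sup_{y\in D_0}|y-y_0|$ there is a set $E_1\subset[r_1,r_2]$ of positive linear Lebesgue measure such that $Q$ is integrable over $S(y_0,r)$ with respect to the Hausdorff measure $\mathcal H^{n-1}$ for every $r\in E_1$. Then for every compact set $E_*\subset D_0$ with $E_*\subset f_m(D)$ for all $m$ there is $\delta_*>0$ such that $h(f_m^{-1}(E_*),\partial D)\ge\delta_*$ for every $m=1,2,\ldots$. -/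

import Mathlib

open MeasureTheory Set
open scoped ENNReal

noncomputable section

namespace InversePoletsky

/-- The Euclidean space `ℝⁿ`. -/
abbrev Rn (n : ℕ) : Type := EuclideanSpace ℝ (Fin n)

/-- The extended space `ℝⁿ ∪ {∞}` with the topology of the one-point compactification. -/
abbrev RnExt (n : ℕ) : Type := OnePoint (Rn n)

/-- A domain in `ℝⁿ`: a nonempty open connected set. -/
def IsDom {n : ℕ} (D : Set (Rn n)) : Prop := IsOpen D ∧ IsConnected D

/-! ### The chordal metric and boundaries in the extended space -/

/-- The spherical (chordal) distance `h` on `ℝⁿ ∪ {∞}`. -/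
def chordal {n : ℕ} : RnExt n → RnExt n → ℝ
  | .infty, .infty => 0
  | .some x, .infty => 1 / √(1 + ‖x‖ ^ 2)
  | .infty, .some y => 1 / √(1 + ‖y‖ ^ 2)
  | .some x, .some y => ‖x - y‖ / (√(1 + ‖x‖ ^ 2) * √(1 + ‖y‖ ^ 2))

/-- `h(A, B) = inf {h(x, y) : x ∈ A, y ∈ B}`, equal to `∞` if `A` or `B` is empty. -/
def chordalDist {n : ℕ} (A B : Set (RnExt n)) : ℝ≥0∞ :=
  ⨅ x ∈ A, ⨅ y ∈ B, ENNReal.ofReal (chordal x y)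

/-- A subset of `ℝⁿ` regarded as a subset of the extended space. -/
def toExt {n : ℕ} (D : Set (Rn n)) : Set (RnExt n) := (fun x : Rn n => (x : RnExt n)) '' D

/-- The boundary of `D ⊆ ℝⁿ`, taken in the extended space (so `∞` belongs to it exactly
when `D` is unbounded). -/
def extBoundary {n : ℕ} (D : Set (Rn n)) : Set (RnExt n) := frontier (toExt D)

/-- No connected component of the boundary of `D` is a single point. -/
def BoundaryNondegenerate {n : ℕ} (D : Set (Rn n)) : Prop :=
  ∀ x ∈ extBoundary D, connectedComponentIn (extBoundary D) x ≠ {x}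

/-! ### Paths and the modulus of a family of paths -/

/-- A path `γ : [a, b] → ℝⁿ`; the values of `toFun` outside `[a, b]` play no role. -/
structure ClosedPath (n : ℕ) where
  /-- left end of the parameter interval -/
  a : ℝ
  /-- right end of the parameter interval -/
  b : ℝ
  lt : a < b
  /-- the parametrization -/
  toFun : ℝ → Rn n
  cont : ContinuousOn toFun (Icc a b)

/-- The length of a path. -/
def ClosedPath.length {n : ℕ} (γ : ClosedPath n) : ℝ≥0∞ := eVariationOn γ.toFun (Icc γ.a γ.b)

/-- A path is rectifiable if its length is finite (for paths on compact intervals this is the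
same as local rectifiability). -/
def ClosedPath.Rectifiable {n : ℕ} (γ : ClosedPath n) : Prop := γ.length ≠ ∞

/-- The integral `∫_γ ρ |dx| = ∫₀^ℓ ρ(γ⁰(s)) ds` of `ρ` along a rectifiable path `γ` of length
`ℓ`, where `γ⁰ : [0, ℓ] → ℝⁿ` is the parametrization of `γ` by arc length. -/
def ClosedPath.lineIntegral {n : ℕ} (γ : ClosedPath n) (ρ : Rn n → ℝ≥0∞) : ℝ≥0∞ :=
  ∫⁻ s in Icc 0 γ.length.toReal, ρ (naturalParameterization γ.toFun (Icc γ.a γ.b) γ.a s)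

/-- `ρ ∈ adm Γ`: `ρ : ℝⁿ → [0, ∞]` is Borel and `∫_γ ρ |dx| ≥ 1` for every (locally) rectifiable
`γ ∈ Γ`. -/
def Admissible {n : ℕ} (Γ : Set (ClosedPath n)) (ρ : Rn n → ℝ≥0∞) : Prop :=
  Measurable ρ ∧ ∀ γ ∈ Γ, γ.Rectifiable → 1 ≤ γ.lineIntegral ρ

/-- The conformal modulus `M(Γ) = M_n(Γ) = inf {∫ ρⁿ dm : ρ ∈ adm Γ}`. -/
def modulus {n : ℕ} (Γ : Set (ClosedPath n)) : ℝ≥0∞ :=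
  ⨅ ρ : Rn n → ℝ≥0∞, ⨅ _ : Admissible Γ ρ, ∫⁻ x, ρ x ^ n

/-! ### The inverse Poletsky inequality -/

/-- The open spherical ring `A(y₀, r₁, r₂)`. -/
def sphericalRing {n : ℕ} (y₀ : Rn n) (r₁ r₂ : ℝ) : Set (Rn n) := {y | r₁ < dist y y₀ ∧ dist y y₀ < r₂}

/-- `Γ_f(y₀, r₁, r₂)`: the paths `γ : [a, b] → D` such that `f ∘ γ` starts on `S(y₀, r₁)`, ends on
`S(y₀, r₂)`, and lies in the ring `A(y₀, r₁, r₂)` for parameters in `(a, b)`. -/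
def liftedRingPaths {n : ℕ} (D : Set (Rn n)) (f : Rn n → Rn n) (y₀ : Rn n) (r₁ r₂ : ℝ) :
    Set (ClosedPath n) :=
  {γ | (∀ t ∈ Icc γ.a γ.b, γ.toFun t ∈ D) ∧
    f (γ.toFun γ.a) ∈ Metric.sphere y₀ r₁ ∧ f (γ.toFun γ.b) ∈ Metric.sphere y₀ r₂ ∧
    ∀ t ∈ Ioo γ.a γ.b, f (γ.toFun t) ∈ sphericalRing y₀ r₁ r₂}

/-- `f : D → ℝⁿ` satisfies the inverse Poletsky inequality with weight `Q` at `y₀`. -/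
def InversePoletskyAt {n : ℕ} (D : Set (Rn n)) (Q : Rn n → ℝ≥0∞) (f : Rn n → Rn n)
    (y₀ : Rn n) : Prop :=
  ∀ r₁ r₂ : ℝ, 0 < r₁ → r₁ < r₂ → ENNReal.ofReal r₂ < ⨆ y ∈ f '' D, edist y y₀ →
    ∀ η : ℝ → ℝ≥0∞, AEMeasurable η (volume.restrict (Ioo r₁ r₂)) →
      1 ≤ ∫⁻ r in Ioo r₁ r₂, η r →
      modulus (liftedRingPaths D f y₀ r₁ r₂) ≤
        ∫⁻ y in sphericalRing y₀ r₁ r₂ ∩ f '' D, Q y * η (dist y y₀) ^ n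

/-! ### Open, discrete and closed mappings and the class `𝔉` -/

/-- `f` is open on the open set `D`. -/
def OpenMapOn {n : ℕ} (D : Set (Rn n)) (f : Rn n → Rn n) : Prop :=
  ∀ U ⊆ D, IsOpen U → IsOpen (f '' U)

/-- Each fibre of `f : D → ℝⁿ` consists of isolated points. -/
def DiscreteMapOn {n : ℕ} (D : Set (Rn n)) (f : Rn n → Rn n) : Prop :=
  ∀ y, IsDiscrete (D ∩ f ⁻¹' {y})

/-- `f` maps relatively closed subsets of `D` to relatively closed subsets of `f(D)`. -/
def ClosedMapOn {n : ℕ} (D : Set (Rn n)) (f : Rn n → Rn n) : Prop :=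
  ∀ A, IsClosed A → ∃ C, IsClosed C ∧ f '' (D ∩ A) = f '' D ∩ C

/-- Membership in the class `𝔉^E_{Q,δ}(D, D₀)`. Mappings are continuous, and only the values of `f`
on `D` play a role. -/
structure MemClass {n : ℕ} (E : Set (Rn n)) (Q : Rn n → ℝ≥0∞) (δ : ℝ) (D D₀ : Set (Rn n))
    (f : Rn n → Rn n) : Prop where
  continuousOn : ContinuousOn f D
  openMap : OpenMapOn D f
  discrete : DiscreteMapOn D f
  closedMap : ClosedMapOn D f
  isDom_image : IsDom (f '' D)
  subset_image : E ⊆ f '' D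
  image_subset : f '' D ⊆ D₀
  poletsky : ∀ y₀ ∈ closure D₀, InversePoletskyAt D Q f y₀
  dist_preimage : ENNReal.ofReal δ ≤ chordalDist (toExt (D ∩ f ⁻¹' E)) (extBoundary D)

/-! ### Kernels of sequences of domains -/

/-- `G` is a domain containing `A₀`, each compact subset of which lies in all but finitely many
of the `Dseq m`. -/
def IsKernelCandidate {n : ℕ} (Dseq : ℕ → Set (Rn n)) (A₀ : Rn n) (G : Set (Rn n)) : Prop :=
  IsDom G ∧ A₀ ∈ G ∧ ∀ K ⊆ G, IsCompact K → ∃ N, ∀ m ≥ N, K ⊆ Dseq m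

/-- `D₀` is the kernel of the sequence of domains `Dseq` with respect to `A₀`. -/
def IsKernel {n : ℕ} (Dseq : ℕ → Set (Rn n)) (A₀ : Rn n) (D₀ : Set (Rn n)) : Prop :=
  (∃ ρ > 0, ∀ m, Metric.ball A₀ ρ ⊆ Dseq m) ∧
    IsKernelCandidate Dseq A₀ D₀ ∧ ∀ G, IsKernelCandidate Dseq A₀ G → G ⊆ D₀

/-- `Dseq` converges to the kernel `D₀`: every subsequence has `D₀` as its kernel. -/
def ConvergesToKernel {n : ℕ} (Dseq : ℕ → Set (Rn n)) (A₀ : Rn n) (D₀ : Set (Rn n)) : Prop :=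
  ∀ φ : ℕ → ℕ, StrictMono φ → IsKernel (fun k => Dseq (φ k)) A₀ D₀

/-! ### Integrability over spheres -/

/-- For every `y₀` in the closure of `D₀` and all `0 < r₁ < r₂ < sup {|y - y₀| : y ∈ D₀}`, the
function `Q` is integrable over `S(y₀, r)` with respect to the `(n-1)`-dimensional Hausdorff measure
for all `r` in some subset of `[r₁, r₂]` of positive Lebesgue measure. -/
def IntegrableOnManySpheres {n : ℕ} (Q : Rn n → ℝ≥0∞) (D₀ : Set (Rn n)) : Prop :=
  ∀ y₀ ∈ closure D₀, ∀ r₁ r₂ : ℝ, 0 < r₁ → r₁ < r₂ →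
    ENNReal.ofReal r₂ < ⨆ y ∈ D₀, edist y y₀ →
    ∃ E₁ ⊆ Icc r₁ r₂, 0 < volume E₁ ∧ ∀ r ∈ E₁,
      AEMeasurable Q ((Measure.hausdorffMeasure ((n : ℝ) - 1)).restrict (Metric.sphere y₀ r)) ∧
      ∫⁻ y in Metric.sphere y₀ r, Q y ∂(Measure.hausdorffMeasure ((n : ℝ) - 1)) < ∞

end InversePoletsky

end

open InversePoletsky

open MeasureTheory Set Filter Topology
open scoped ENNReal NNReal

namespace InversePoletsky

/-! Choose `e ∈ E` and a compact connected `F ⊆ D₀` containing `e` and `Estar`. Cover `F` by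
finitely many balls `B(y, r)` with `B(y, 3r) ⊆ D₀`. Kernel convergence puts `F` and these larger
balls into `f m '' D` for all `m ≥ N`. Integrability of `Q` on many spheres supplies a weight `η`
making the right side of the inverse Poletsky inequality finite, so the moduli of the families
`Γ_f(y, r, 2r)` are bounded independently of `m` (`exists_cover_modulus_lt`).

Suppose a point of the preimage of `Estar` lies very close to a boundary point `b`. The preimage of
`E` stays away from `b`, and since `f m` is open and closed, the preimage of `F` cannot stop on one
side of a sphere: it meets every sphere about `b` between the two scales. The component of `b` in
the boundary is not a point, so small spheres about `b` also contain points outside `D`. A path in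
such a sphere from a point over `F` to a point outside `D` leaves `D`; as `f m` is proper onto its
image, the image path must leave a ball `B(y, 2r)` after starting in `B(y, r)`, and hence contains a
member of `Γ_f(y, r, 2r)` (`exists_subpath_mem_liftedRingPaths`).

So the supremum of admissible densities for these finitely many families has integral at least `1`
along every Lipschitz path in the sphere joining the two points. Its `n`-energy is then at least a
constant times the logarithm of the ratio of the scales (`exists_energy_bound`), which contradicts
the uniform modulus bound once the ratio is large. If `b = ∞`, large spheres about `0` play the same
role. The finitely many `m < N` are handled by properness alone, and compactness of the extended
space turns the local statements into one distance.

The energy bound on one sphere (`exists_sphere_energy_bound`) comes from averaging over a family of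
curves: broken lines from `c` through a variable point `z` to `k`, projected radially to the sphere.
-/

/-! ### The chordal metric. -/

/-- The inverse stereographic projection onto the sphere of diameter `1`. -/
noncomputable def stereo {n : ℕ} (x : RnExt n) : Rn n × ℝ :=
  x.elim 0 fun x => ((1 + ‖x‖ ^ 2)⁻¹ • x, (1 + ‖x‖ ^ 2)⁻¹)

theorem continuous_stereo {n : ℕ} : Continuous (stereo (n := n)) := by
  have hpos : ∀ x : Rn n, (1 + ‖x‖ ^ 2) ≠ 0 := fun x => by positivity
  rw [OnePoint.continuous_iff]
  constructor
  · rw [coclosedCompact_eq_cocompact]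
    have h1 : Tendsto (fun x : Rn n => ‖x‖⁻¹) (cocompact _) (𝓝 0) :=
      tendsto_inv_atTop_zero.comp (tendsto_norm_cocompact_atTop (E := Rn n))
    have h2 : ∀ x : Rn n, (1 + ‖x‖ ^ 2)⁻¹ * ‖x‖ ≤ ‖x‖⁻¹ := by
      intro x
      rcases (norm_nonneg x).eq_or_lt with h | h
      · simp [← h]
      · rw [inv_mul_le_iff₀ (by positivity)]
        field_simp
        linarith
    change Tendsto (fun x : Rn n => ((1 + ‖x‖ ^ 2)⁻¹ • x, (1 + ‖x‖ ^ 2)⁻¹)) _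
      (𝓝 ((0 : Rn n), (0 : ℝ)))
    refine Tendsto.prodMk_nhds ?_ ?_
    · refine squeeze_zero_norm (fun x => ?_) h1
      rw [norm_smul, Real.norm_of_nonneg (by positivity)]
      exact h2 x
    · refine tendsto_inv_atTop_zero.comp ?_
      refine tendsto_atTop_add_const_left _ _ ?_
      exact (tendsto_pow_atTop two_ne_zero).comp (tendsto_norm_cocompact_atTop (E := Rn n))
  · change Continuous (fun x : Rn n => ((1 + ‖x‖ ^ 2)⁻¹ • x, (1 + ‖x‖ ^ 2)⁻¹))
    fun_prop (disch := exact hpos _)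

/-- Stereographic projection turns the chordal metric into a Euclidean distance, so its continuity,
including at `∞`, reduces to that of `stereo`. -/
theorem chordal_eq_sqrt {n : ℕ} (x y : RnExt n) :
    chordal x y = √(‖(stereo x).1 - (stereo y).1‖ ^ 2 + ((stereo x).2 - (stereo y).2) ^ 2) := by
  have key : ∀ x : Rn n, 1 / √(1 + ‖x‖ ^ 2)
      = √(‖(1 + ‖x‖ ^ 2)⁻¹ • x‖ ^ 2 + ((1 + ‖x‖ ^ 2)⁻¹) ^ 2) := by
    intro x
    rw [norm_smul, Real.norm_of_nonneg (by positivity), one_div, ← Real.sqrt_inv]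
    congr 1
    field_simp
    ring
  induction x using OnePoint.rec with
  | infty =>
    induction y using OnePoint.rec with
    | infty => simp [chordal]
    | coe y =>
      simp only [stereo, OnePoint.elim_infty, OnePoint.elim_some, Prod.fst_zero, Prod.snd_zero,
        zero_sub, norm_neg, neg_sq]
      exact key y
  | coe x =>
    induction y using OnePoint.rec with
    | infty =>
      simp only [stereo, OnePoint.elim_infty, OnePoint.elim_some, Prod.fst_zero, Prod.snd_zero,
        sub_zero]
      exact key x
    | coe y =>
      simp only [stereo, OnePoint.elim_some]
      change ‖x - y‖ / (√(1 + ‖x‖ ^ 2) * √(1 + ‖y‖ ^ 2)) = _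
      rw [← Real.sqrt_mul (by positivity), ← Real.sqrt_sq (norm_nonneg (x - y)),
        ← Real.sqrt_div (by positivity)]
      congr 1
      rw [norm_sub_sq_real, norm_sub_sq_real, norm_smul, norm_smul, real_inner_smul_left,
        real_inner_smul_right, Real.norm_of_nonneg (by positivity),
        Real.norm_of_nonneg (by positivity)]
      field_simp
      ring

theorem continuous_chordal {n : ℕ} : Continuous fun p : RnExt n × RnExt n => chordal p.1 p.2 := by
  simp only [chordal_eq_sqrt]
  have := continuous_stereo (n := n)
  fun_prop

theorem chordal_pos {n : ℕ} {x y : RnExt n} (h : x ≠ y) : 0 < chordal x y := by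
  induction x using OnePoint.rec with
  | infty =>
    induction y using OnePoint.rec with
    | infty => exact absurd rfl h
    | coe y => change 0 < 1 / √(1 + ‖y‖ ^ 2); positivity
  | coe x =>
    induction y using OnePoint.rec with
    | infty => change 0 < 1 / √(1 + ‖x‖ ^ 2); positivity
    | coe y =>
      have : 0 < ‖x - y‖ := norm_sub_pos_iff.2 fun hxy => h (by rw [hxy])
      change 0 < ‖x - y‖ / (√(1 + ‖x‖ ^ 2) * √(1 + ‖y‖ ^ 2))
      positivity

theorem chordal_self {n : ℕ} (x : RnExt n) : chordal x x = 0 := by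
  simp [chordal_eq_sqrt]

/-- Disjoint compact sets have positive chordal distance. -/
theorem exists_pos_le_chordalDist {n : ℕ} {K B : Set (RnExt n)} (hK : IsCompact K)
    (hB : IsCompact B) (hKB : Disjoint K B) :
    ∃ δ : ℝ, 0 < δ ∧ ENNReal.ofReal δ ≤ chordalDist K B := by
  obtain hE | hne := (K ×ˢ B).eq_empty_or_nonempty
  -- With one set empty the distance is `∞`, so any `δ` works.
  · refine ⟨1, one_pos, le_iInf₂ fun x hx => le_iInf₂ fun y hy => ?_⟩
    exact absurd (mk_mem_prod hx hy) (by simp [hE])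
  · obtain ⟨p, hp, hmin⟩ := (hK.prod hB).exists_isMinOn hne continuous_chordal.continuousOn
    refine ⟨chordal p.1 p.2, chordal_pos fun h => ?_, le_iInf₂ fun x hx => le_iInf₂ fun y hy => ?_⟩
    · exact disjoint_left.1 hKB hp.1 (h ▸ hp.2)
    · exact ENNReal.ofReal_le_ofReal (hmin (mk_mem_prod hx hy))

/-- A point of `B` has a neighbourhood disjoint from every set at chordal distance at least `δ`
from `B`. -/
theorem eventually_notMem_of_le_chordalDist {n : ℕ} {B : Set (RnExt n)} {b : RnExt n} (hb : b ∈ B)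
    {δ : ℝ} (hδ : 0 < δ) :
    ∀ᶠ x in 𝓝 b, ∀ A : Set (RnExt n), ENNReal.ofReal δ ≤ chordalDist A B → x ∉ A := by
  have hc : Continuous fun x => chordal x b :=
    continuous_chordal.comp (continuous_id.prodMk continuous_const)
  have : ∀ᶠ x in 𝓝 b, chordal x b < δ :=
    hc.continuousAt.eventually (gt_mem_nhds (by simpa [chordal_self] using hδ))
  filter_upwards [this] with x hx A hA hxA
  have h1 : ENNReal.ofReal δ ≤ ENNReal.ofReal (chordal x b) :=
    hA.trans ((iInf₂_le x hxA).trans (iInf₂_le b hb))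
  exact absurd h1 (not_le.2 ((ENNReal.ofReal_lt_ofReal_iff hδ).2 hx))

/-! ### Polar coordinates; surface measure against Hausdorff measure. -/

/-- The surface measure on the unit sphere of `ℝⁿ`. -/
noncomputable abbrev sphereMeasure (n : ℕ) : Measure (Metric.sphere (0 : Rn n) 1) :=
  (volume : Measure (Rn n)).toSphere

/-- Integration in polar coordinates centred at `x₀`. -/
theorem lintegral_polar {n : ℕ} (hn : 1 ≤ n) {g : Rn n → ℝ≥0∞} (hg : Measurable g) (x₀ : Rn n) :
    ∫⁻ x, g x = ∫⁻ r in Ioi (0 : ℝ), ENNReal.ofReal (r ^ (n - 1)) *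
      ∫⁻ θ, g (x₀ + r • θ.1) ∂sphereMeasure n := by
  have : NeZero n := ⟨by omega⟩
  have hd : Module.finrank ℝ (Rn n) = n := by simp
  have hmp := (volume : Measure (Rn n)).measurePreserving_homeomorphUnitSphereProd
  rw [hd] at hmp
  set F : Metric.sphere (0 : Rn n) 1 × Ioi (0 : ℝ) → ℝ≥0∞ := fun p => g (x₀ + p.2.1 • p.1.1)
  have hF : Measurable F := by
    refine hg.comp ?_
    fun_prop
  calc ∫⁻ x, g x = ∫⁻ x, g (x₀ + x) := (lintegral_add_left_eq_self g x₀).symm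
    _ = ∫⁻ x in ({0}ᶜ : Set (Rn n)), g (x₀ + x) := by rw [restrict_compl_singleton]
    _ = ∫⁻ x : ({0}ᶜ : Set (Rn n)), g (x₀ + x) ∂(volume.comap Subtype.val) :=
      (lintegral_subtype_comap (measurableSet_singleton _).compl fun x => g (x₀ + x)).symm
    _ = ∫⁻ x : ({0}ᶜ : Set (Rn n)), F (homeomorphUnitSphereProd (Rn n) x)
          ∂(volume.comap Subtype.val) := by
      refine lintegral_congr fun x => ?_
      have hx : ‖(x : Rn n)‖ ≠ 0 := norm_ne_zero_iff.2 x.2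
      simp only [F, homeomorphUnitSphereProd_apply_snd_coe, homeomorphUnitSphereProd_apply_fst_coe]
      rw [smul_inv_smul₀ hx]
    _ = ∫⁻ p, F p ∂((sphereMeasure n).prod (Measure.volumeIoiPow (n - 1))) :=
      hmp.lintegral_comp hF
    _ = ∫⁻ r : Ioi (0 : ℝ), ∫⁻ θ, F (θ, r) ∂sphereMeasure n ∂(Measure.volumeIoiPow (n - 1)) :=
      lintegral_prod_symm' F hF
    _ = ∫⁻ r : Ioi (0 : ℝ), ENNReal.ofReal (r.1 ^ (n - 1)) * ∫⁻ θ, F (θ, r) ∂sphereMeasure n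
          ∂(volume.comap Subtype.val) := by
      rw [Measure.volumeIoiPow, lintegral_withDensity_eq_lintegral_mul]
      · rfl
      · fun_prop
      · exact hF.lintegral_prod_left'
    _ = _ := lintegral_subtype_comap measurableSet_Ioi fun r : ℝ =>
        ENNReal.ofReal (r ^ (n - 1)) * ∫⁻ θ, g (x₀ + r • θ.1) ∂sphereMeasure n

theorem measurable_comp_sphere {n : ℕ} {g : Rn n → ℝ≥0∞} (hg : Measurable g) (x₀ : Rn n) (r : ℝ) :
    Measurable fun θ : Metric.sphere (0 : Rn n) 1 => g (x₀ + r • θ.1) :=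
  hg.comp (by fun_prop)

theorem measurable_lintegral_sphere {n : ℕ} {g : Rn n → ℝ≥0∞} (hg : Measurable g) (x₀ : Rn n) :
    Measurable fun r : ℝ => ∫⁻ θ, g (x₀ + r • θ.1) ∂sphereMeasure n := by
  have : Measurable fun p : ℝ × Metric.sphere (0 : Rn n) 1 => g (x₀ + p.1 • p.2.1) :=
    hg.comp (by fun_prop)
  exact this.lintegral_prod_right'

/-- If two functions agree almost everywhere, they agree almost everywhere on almost every sphere. -/
theorem ae_ae_sphere_eq {n : ℕ} (hn : 1 ≤ n) {g g' : Rn n → ℝ≥0∞} (h : g =ᵐ[volume] g')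
    (x₀ : Rn n) :
    ∀ᵐ r ∂(volume.restrict (Ioi (0 : ℝ))), ∀ᵐ θ ∂sphereMeasure n,
      g (x₀ + r • θ.1) = g' (x₀ + r • θ.1) := by
  obtain ⟨Z, hZsub, hZm, hZ⟩ := exists_measurable_superset_of_null (ae_iff.1 h)
  have hind : Measurable (Z.indicator (1 : Rn n → ℝ≥0∞)) := measurable_one.indicator hZm
  have h0 : ∫⁻ x, Z.indicator (1 : Rn n → ℝ≥0∞) x = 0 := by rw [lintegral_indicator_one hZm, hZ]
  have hm : Measurable fun r : ℝ => ENNReal.ofReal (r ^ (n - 1)) *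
      ∫⁻ θ, Z.indicator (1 : Rn n → ℝ≥0∞) (x₀ + r • θ.1) ∂sphereMeasure n :=
    (by fun_prop : Measurable fun r : ℝ => ENNReal.ofReal (r ^ (n - 1))).mul
      (measurable_lintegral_sphere hind x₀)
  rw [lintegral_polar hn hind x₀, lintegral_eq_zero_iff hm] at h0
  filter_upwards [h0, ae_restrict_mem measurableSet_Ioi] with r hr hr0
  have hr0' : 0 < r := hr0
  have hpow : ENNReal.ofReal (r ^ (n - 1)) ≠ 0 := by
    rw [Ne, ENNReal.ofReal_eq_zero, not_le]
    positivity
  have h1 : ∫⁻ θ, Z.indicator (1 : Rn n → ℝ≥0∞) (x₀ + r • θ.1) ∂sphereMeasure n = 0 :=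
    (mul_eq_zero.1 hr).resolve_left hpow
  rw [lintegral_eq_zero_iff (measurable_comp_sphere hind x₀ r)] at h1
  filter_upwards [h1] with θ hθ
  by_contra hne
  have : x₀ + r • θ.1 ∈ Z := hZsub hne
  simp [this] at hθ

/-- A ball of radius `d` meets the unit sphere in a set of measure at most `C d ^ (n - 1)`. -/
theorem sphereMeasure_closedBall_le {n : ℕ} (hn : 1 ≤ n) (p : Rn n) {d : ℝ} (hd : 0 < d) :
    sphereMeasure n (Subtype.val ⁻¹' Metric.closedBall p d) ≤
      ENNReal.ofReal (d ^ (n - 1)) * (2 ^ n * volume (Metric.closedBall (0 : Rn n) 1)) := by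
  have : NeZero n := ⟨by omega⟩
  set A : Set (Metric.sphere (0 : Rn n) 1) := Subtype.val ⁻¹' Metric.closedBall p d
  have hA : MeasurableSet A := measurable_subtype_coe Metric.isClosed_closedBall.measurableSet
  -- The shell `{rθ : θ ∈ A, 1 < r < 1 + d}` over the cap `A` lies in `B(p, 2d)`, and its volume is
  -- at least `d` times the measure of `A`.
  have h1 : ENNReal.ofReal d * sphereMeasure n A ≤ volume (Metric.closedBall p (2 * d)) := by
    have hind : Measurable ((Metric.closedBall p (2 * d)).indicator (1 : Rn n → ℝ≥0∞)) :=
      measurable_one.indicator Metric.isClosed_closedBall.measurableSet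
    rw [← lintegral_indicator_one Metric.isClosed_closedBall.measurableSet,
      lintegral_polar hn hind 0]
    calc ENNReal.ofReal d * sphereMeasure n A
        = ∫⁻ _r in Ioo (1 : ℝ) (1 + d), sphereMeasure n A := by
          rw [setLIntegral_const, Real.volume_Ioo, mul_comm]; simp
      _ ≤ ∫⁻ r in Ioo (1 : ℝ) (1 + d), ENNReal.ofReal (r ^ (n - 1)) *
          ∫⁻ θ, (Metric.closedBall p (2 * d)).indicator (1 : Rn n → ℝ≥0∞) (0 + r • θ.1)
            ∂sphereMeasure n := by
          refine setLIntegral_mono' measurableSet_Ioo fun r hr => ?_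
          rw [← one_mul (sphereMeasure n A), ← lintegral_indicator_one hA]
          refine mul_le_mul' ?_ (lintegral_mono fun θ => ?_)
          · rw [ENNReal.one_le_ofReal]; exact one_le_pow₀ hr.1.le
          · by_cases hθ : θ ∈ A
            · have hmem : 0 + r • θ.1 ∈ Metric.closedBall p (2 * d) := by
                have h2 : dist θ.1 p ≤ d := hθ
                have h3 : ‖θ.1‖ = 1 := by simp
                have h4 : r • θ.1 - p = (r - 1) • θ.1 + (θ.1 - p) := by module
                rw [zero_add, Metric.mem_closedBall, dist_eq_norm, h4]
                refine (norm_add_le _ _).trans ?_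
                rw [norm_smul, h3, mul_one, Real.norm_of_nonneg (by linarith [hr.1]),
                  ← dist_eq_norm]
                linarith [hr.2]
              rw [indicator_of_mem hθ, indicator_of_mem hmem]; rfl
            · simp [hθ]
      _ ≤ _ := lintegral_mono_set fun r hr => lt_trans one_pos hr.1
  rw [Measure.addHaar_closedBall' _ _ (by positivity), finrank_euclideanSpace_fin] at h1
  have h2 : ENNReal.ofReal ((2 * d) ^ n) =
      ENNReal.ofReal d * (ENNReal.ofReal (d ^ (n - 1)) * 2 ^ n) := by
    obtain ⟨k, rfl⟩ : ∃ k, n = k + 1 := ⟨n - 1, by omega⟩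
    rw [← ENNReal.ofReal_ofNat 2, ← ENNReal.ofReal_pow (by norm_num),
      ← ENNReal.ofReal_mul (by positivity), ← ENNReal.ofReal_mul (by positivity)]
    congr 1
    simp only [add_tsub_cancel_right]
    ring
  rw [h2, mul_assoc, mul_assoc] at h1
  exact (ENNReal.mul_le_mul_iff_right (by simpa using hd) ENNReal.ofReal_ne_top).1 h1

/-- A function integrable over the sphere `S(y₀, r)` with respect to the Hausdorff measure is
integrable with respect to the rescaled surface measure. -/
theorem lintegral_sphereMeasure_lt_top {n : ℕ} (hn : 2 ≤ n) {Q : Rn n → ℝ≥0∞} {y₀ : Rn n} {r : ℝ}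
    (hr : 0 < r)
    (hQ : ∫⁻ y in Metric.sphere y₀ r, Q y ∂(Measure.hausdorffMeasure ((n : ℝ) - 1)) < ∞) :
    ∫⁻ θ, Q (y₀ + r • θ.1) ∂sphereMeasure n < ∞ := by
  set φ : Metric.sphere (0 : Rn n) 1 → Rn n := fun θ => y₀ + r • θ.1 with hφ
  have hφc : Continuous φ := by fun_prop
  have hφi : Function.Injective φ := fun θ θ' h => by
    have : r • θ.1 = r • θ'.1 := add_left_cancel h
    exact Subtype.ext (smul_right_injective _ hr.ne' this)
  have hφe : MeasurableEmbedding φ := (hφc.isClosedEmbedding hφi).measurableEmbedding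
  have hφS : ∀ θ, φ θ ∈ Metric.sphere y₀ r := fun θ => by
    simp [hφ, norm_smul, abs_of_pos hr]
  set τ := (sphereMeasure n).map φ with hτ
  set V : ℝ≥0∞ := 2 ^ n * volume (Metric.closedBall (0 : Rn n) 1)
  have hV : V ≠ ∞ := ENNReal.mul_ne_top (by simp) (isCompact_closedBall _ _).measure_lt_top.ne
  -- The summand `1` only ensures `C ≠ 0`.
  set C : ℝ≥0∞ := ENNReal.ofReal ((r⁻¹) ^ (n - 1)) * V + 1
  have hC : C ≠ ∞ := by simp [C, ENNReal.mul_ne_top, hV]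
  have hC0 : C ≠ 0 := by simp [C]
  have hbound : ∀ s : Set (Rn n), Metric.ediam s ≤ 1 →
      τ s ≤ C * Metric.ediam s ^ ((n : ℝ) - 1) := by
    intro s hs
    obtain rfl | ⟨x, hx⟩ := s.eq_empty_or_nonempty
    · simp
    have hdiam : Metric.ediam s ≠ ∞ := ne_top_of_le_ne_top ENNReal.one_ne_top hs
    set e := (Metric.ediam s).toReal with he
    have hee : Metric.ediam s = ENNReal.ofReal e := (ENNReal.ofReal_toReal hdiam).symm
    have he0 : 0 ≤ e := ENNReal.toReal_nonneg
    -- The cap estimate needs a positive radius while `e` may be `0`; hence `d > e` here, and then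
    -- `d → e`.
    have h1 : ∀ d > e, τ s ≤ ENNReal.ofReal ((r⁻¹ * d) ^ (n - 1)) * V := by
      intro d hd
      have hd0 : 0 < d := he0.trans_lt hd
      rw [hτ, hφe.map_apply]
      refine (measure_mono fun θ hθ => ?_).trans
        (sphereMeasure_closedBall_le (by omega) (r⁻¹ • (x - y₀)) (d := r⁻¹ * d) (by positivity))
      have h2 : dist (φ θ) x ≤ e := by
        rw [dist_edist]
        exact ENNReal.toReal_mono hdiam (Metric.edist_le_ediam_of_mem hθ hx)
      have h3 : θ.1 - r⁻¹ • (x - y₀) = r⁻¹ • (φ θ - x) := by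
        have : θ.1 = r⁻¹ • (r • θ.1) := (inv_smul_smul₀ hr.ne' _).symm
        rw [hφ]
        conv_lhs => rw [this]
        module
      rw [mem_preimage, Metric.mem_closedBall, dist_eq_norm, h3, norm_smul,
        Real.norm_of_nonneg (by positivity), ← dist_eq_norm]
      gcongr
      linarith
    have h2 : τ s ≤ ENNReal.ofReal ((r⁻¹ * e) ^ (n - 1)) * V := by
      have hcont : ContinuousAt (fun d : ℝ => ENNReal.ofReal ((r⁻¹ * d) ^ (n - 1)) * V) e :=
        (ENNReal.continuous_mul_const hV).continuousAt.comp
          (ENNReal.continuous_ofReal.comp (by fun_prop)).continuousAt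
      exact ge_of_tendsto (hcont.mono_left nhdsWithin_le_nhds)
        (eventually_nhdsWithin_of_forall (s := Ioi e) fun d hd => h1 d hd)
    have h3 : Metric.ediam s ^ ((n : ℝ) - 1) = ENNReal.ofReal (e ^ (n - 1)) := by
      rw [hee, ENNReal.ofReal_pow he0, ← ENNReal.rpow_natCast, Nat.cast_sub (by omega),
        Nat.cast_one]
    rw [h3]
    refine h2.trans ?_
    rw [mul_pow, ENNReal.ofReal_mul (by positivity), mul_right_comm]
    gcongr
    exact le_self_add
  -- A measure bounded by `diam ^ (n - 1)` on small sets is dominated by the Hausdorff measure.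
  have hle : C⁻¹ • τ ≤ Measure.hausdorffMeasure ((n : ℝ) - 1) := by
    refine Measure.le_hausdorffMeasure _ _ 1 one_pos fun s hs => ?_
    rw [Measure.smul_apply, smul_eq_mul]
    calc C⁻¹ * τ s ≤ C⁻¹ * (C * Metric.ediam s ^ ((n : ℝ) - 1)) := by gcongr; exact hbound s hs
      _ = _ := by rw [← mul_assoc, ENNReal.inv_mul_cancel hC0 hC, one_mul]
  have h1 : ∫⁻ θ, Q (φ θ) ∂sphereMeasure n = ∫⁻ y in Metric.sphere y₀ r, Q y ∂τ := by
    rw [hτ, hφe.restrict_map, hφe.lintegral_map]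
    have : φ ⁻¹' Metric.sphere y₀ r = univ := eq_univ_of_forall hφS
    rw [this, Measure.restrict_univ]
  have h2 : C⁻¹ * ∫⁻ y in Metric.sphere y₀ r, Q y ∂τ < ∞ := by
    rw [← smul_eq_mul, ← lintegral_smul_measure, ← Measure.restrict_smul]
    exact (lintegral_mono' (Measure.restrict_mono_measure hle _) le_rfl).trans_lt hQ
  change ∫⁻ θ, Q (φ θ) ∂sphereMeasure n < ∞
  rw [h1]
  by_contra htop
  rw [not_lt_top_iff.1 htop, ENNReal.mul_top (ENNReal.inv_ne_zero.2 hC)] at h2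
  exact lt_irrefl _ h2

/-! ### The integrable weight. -/

/-- A weight `η` of total mass at least `1` on `(r₁, r₂)` for which `Q η(|y - y₀|)ⁿ` is
integrable over the ring. -/
theorem exists_weight {n : ℕ} (hn : 2 ≤ n) {Q : Rn n → ℝ≥0∞} (hQ : AEMeasurable Q volume)
    {D₀ : Set (Rn n)} (hQint : IntegrableOnManySpheres Q D₀) {y₀ : Rn n} (hy₀ : y₀ ∈ closure D₀)
    {r₁ r₂ : ℝ} (h₁ : 0 < r₁) (h₁₂ : r₁ < r₂) (h₂ : ENNReal.ofReal r₂ < ⨆ y ∈ D₀, edist y y₀) :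
    ∃ η : ℝ → ℝ≥0∞, Measurable η ∧ 1 ≤ ∫⁻ r in Ioo r₁ r₂, η r ∧
      ∫⁻ y in sphericalRing y₀ r₁ r₂, Q y * η (dist y y₀) ^ n < ∞ := by
  obtain ⟨E₁, hE₁, hE₁pos, hE₁int⟩ := hQint y₀ hy₀ r₁ r₂ h₁ h₁₂ h₂
  set Q' := hQ.mk Q
  have hQ'm : Measurable Q' := hQ.measurable_mk
  have hQQ' : Q =ᵐ[volume] Q' := hQ.ae_eq_mk
  set q : ℝ → ℝ≥0∞ := fun r => ∫⁻ θ, Q' (y₀ + r • θ.1) ∂sphereMeasure n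
  have hq : Measurable q := measurable_lintegral_sphere hQ'm y₀
  -- `E₁` need not be measurable, but almost all of it lies in the measurable set where the Borel
  -- representative has finite sphere integral.
  have hae : ∀ᵐ r ∂(volume : Measure ℝ), r ∈ E₁ → r ∈ Ioo r₁ r₂ ∩ {r | q r < ∞} := by
    have h1 := (ae_restrict_iff' measurableSet_Ioi).1 (ae_ae_sphere_eq (by omega) hQQ' y₀)
    filter_upwards [h1, compl_mem_ae_iff.2 (measure_singleton r₁),
      compl_mem_ae_iff.2 (measure_singleton r₂)] with r hr hne₁ hne₂ hrE
    have hr0 : 0 < r := h₁.trans_le (hE₁ hrE).1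
    refine ⟨⟨lt_of_le_of_ne (hE₁ hrE).1 (Ne.symm hne₁), lt_of_le_of_ne (hE₁ hrE).2 hne₂⟩, ?_⟩
    change q r < ∞
    rw [show q r = ∫⁻ θ, Q (y₀ + r • θ.1) ∂sphereMeasure n from (lintegral_congr_ae (hr hr0)).symm]
    exact lintegral_sphereMeasure_lt_top hn hr0 (hE₁int r hrE).2
  have hpos : 0 < volume (Ioo r₁ r₂ ∩ {r | q r < ∞}) := hE₁pos.trans_le (measure_mono_ae hae)
  obtain ⟨N, hN⟩ : ∃ N : ℕ, 0 < volume (Ioo r₁ r₂ ∩ {r | q r ≤ N}) := by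
    by_contra! hcon
    refine hpos.ne' (measure_mono_null ?_ (measure_iUnion_null fun N => le_zero_iff.1 (hcon N)))
    rintro r ⟨hr, hqr⟩
    obtain ⟨N, hN⟩ := ENNReal.exists_nat_gt (ne_of_lt hqr)
    exact mem_iUnion.2 ⟨N, hr, hN.le⟩
  set T := Ioo r₁ r₂ ∩ {r | q r ≤ N}
  have hT : MeasurableSet T := measurableSet_Ioo.inter (measurableSet_le hq measurable_const)
  have hTtop : volume T ≠ ∞ :=
    ne_top_of_le_ne_top (by simp) (measure_mono (inter_subset_left (s := Ioo r₁ r₂)))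
  -- On `T` the sphere integrals are at most `N`, so the normalized indicator of `T` suffices.
  set η : ℝ → ℝ≥0∞ := T.indicator fun _ => (volume T)⁻¹ with hη
  have hηm : Measurable η := measurable_const.indicator hT
  refine ⟨η, hηm, ?_, ?_⟩
  · rw [hη, lintegral_indicator_const hT, Measure.restrict_apply hT,
      inter_eq_left.2 inter_subset_left, ENNReal.inv_mul_cancel hN.ne' hTtop]
  · have hgm : Measurable fun y => Q' y * η (dist y y₀) ^ n :=
      hQ'm.mul ((hηm.comp (by fun_prop)).pow_const n)
    calc ∫⁻ y in sphericalRing y₀ r₁ r₂, Q y * η (dist y y₀) ^ n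
        ≤ ∫⁻ y, Q y * η (dist y y₀) ^ n := setLIntegral_le_lintegral _ _
      _ = ∫⁻ y, Q' y * η (dist y y₀) ^ n := by
        refine lintegral_congr_ae ?_
        filter_upwards [hQQ'] with y hy
        rw [hy]
      _ = ∫⁻ r in Ioi (0 : ℝ), ENNReal.ofReal (r ^ (n - 1)) * (q r * η r ^ n) := by
        rw [lintegral_polar (by omega) hgm y₀]
        refine setLIntegral_congr_fun measurableSet_Ioi fun r hr => ?_
        have hr0 : 0 < r := hr
        have hd : ∀ θ : Metric.sphere (0 : Rn n) 1, dist (y₀ + r • θ.1) y₀ = r := fun θ => by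
          simp [norm_smul, abs_of_pos hr0]
        simp only [hd]
        rw [lintegral_mul_const _ (measurable_comp_sphere hQ'm y₀ r)]
      _ ≤ ∫⁻ r in Ioi (0 : ℝ), T.indicator
          (fun _ => ENNReal.ofReal (r₂ ^ (n - 1)) * (N * (volume T)⁻¹ ^ n)) r := by
        refine setLIntegral_mono' measurableSet_Ioi fun r hr => ?_
        have hr0 : (0 : ℝ) < r := hr
        by_cases hrT : r ∈ T
        · simp only [hη, indicator_of_mem hrT]
          gcongr
          · exact hrT.1.2.le
          · exact hrT.2
        · simp [hη, hrT, show n ≠ 0 by omega]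
      _ ≤ ENNReal.ofReal (r₂ ^ (n - 1)) * (N * (volume T)⁻¹ ^ n) * volume T := by
        rw [lintegral_indicator_const hT]
        gcongr
        exact Measure.restrict_le_self
      _ < ∞ := by
        refine ENNReal.mul_lt_top (ENNReal.mul_lt_top ENNReal.ofReal_lt_top
          (ENNReal.mul_lt_top (ENNReal.natCast_lt_top N) ?_)) hTtop.lt_top
        exact ENNReal.pow_lt_top (ENNReal.inv_lt_top.2 hN)

/-! ### Line integrals along Lipschitz paths. -/

/-- The line integral along an `L`-Lipschitz path is at most `L` times the integral in the
parameter. -/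
theorem ClosedPath.lineIntegral_le_of_lipschitzOnWith {n : ℕ} (γ : ClosedPath n) {L : ℝ≥0}
    (hL : LipschitzOnWith L γ.toFun (Icc γ.a γ.b)) (ρ : Rn n → ℝ≥0∞) :
    γ.lineIntegral ρ ≤ L * ∫⁻ t in Icc γ.a γ.b, ρ (γ.toFun t) := by
  set s := Icc γ.a γ.b with hs
  have ha : γ.a ∈ s := left_mem_Icc.2 γ.lt.le
  have hb : γ.b ∈ s := right_mem_Icc.2 γ.lt.le
  have hbv : LocallyBoundedVariationOn γ.toFun s := hL.locallyBoundedVariationOn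
  set V := variationOnFromTo γ.toFun s γ.a with hV
  have hVmono : MonotoneOn V s := variationOnFromTo.monotoneOn hbv ha
  have hstep : ∀ u ∈ s, ∀ t ∈ s, u ≤ t → V t ≤ V u + L * (t - u) := by
    intro u hu t ht hut
    rw [hV, ← variationOnFromTo.add hbv ha hu ht, variationOnFromTo.eq_of_le _ _ hut]
    gcongr
    refine ENNReal.toReal_le_of_le_ofReal (mul_nonneg L.2 (sub_nonneg.2 hut)) ?_
    have h1 := (hL.mono (inter_subset_left (s := s) (t := Icc u t))).comp_eVariationOn_le
      (mapsTo_id (s ∩ Icc u t))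
    rw [Function.comp_id, (monotoneOn_id (s := s)).eVariationOn_eq hu ht] at h1
    rwa [ENNReal.ofReal_mul L.coe_nonneg, ENNReal.ofReal_coe_nnreal]
  have hVlip : LipschitzOnWith L V s := by
    refine LipschitzOnWith.of_le_add_mul L fun t ht u hu => ?_
    rcases le_total u t with h | h
    · rw [Real.dist_eq, abs_of_nonneg (sub_nonneg.2 h)]
      exact hstep u hu t ht h
    · exact (hVmono ht hu h).trans (le_add_of_nonneg_right (by positivity))
  have hV0 : V γ.a = 0 := variationOnFromTo.self _ _ _
  have hV1 : V γ.b = γ.length.toReal := by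
    rw [hV, variationOnFromTo.eq_of_le _ _ γ.lt.le, inter_self]
    rfl
  have hsurj : Icc 0 γ.length.toReal ⊆ V '' s := by
    rw [← hV0, ← hV1]
    exact intermediate_value_Icc γ.lt.le hVlip.continuousOn
  have hVm : AEMeasurable V (volume.restrict s) :=
    hVlip.continuousOn.aemeasurable measurableSet_Icc
  -- The arc length function `V` is `L`-Lipschitz and covers `[0, ℓ]`, so a set there has measure at
  -- most `L` times that of its preimage.
  have hle : volume.restrict (Icc 0 γ.length.toReal) ≤
      (L : ℝ≥0∞) • (volume.restrict s).map V := by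
    refine Measure.le_iff.2 fun B hB => ?_
    rw [Measure.smul_apply, smul_eq_mul, Measure.map_apply_of_aemeasurable hVm hB,
      Measure.restrict_apply hB, Measure.restrict_apply₀' measurableSet_Icc.nullMeasurableSet]
    have h1 : B ∩ Icc 0 γ.length.toReal ⊆ V '' (V ⁻¹' B ∩ s) := by
      rintro x ⟨hxB, hx⟩
      obtain ⟨t, ht, rfl⟩ := hsurj hx
      exact ⟨t, ⟨hxB, ht⟩, rfl⟩
    have h2 := (hVlip.mono (inter_subset_right (s := V ⁻¹' B))).hausdorffMeasure_image_le
      zero_le_one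
    rw [hausdorffMeasure_real, ENNReal.rpow_one] at h2
    exact (measure_mono h1).trans h2
  set γ₀ := naturalParameterization γ.toFun s γ.a with hγ₀
  calc γ.lineIntegral ρ = ∫⁻ x in Icc 0 γ.length.toReal, ρ (γ₀ x) := rfl
    _ ≤ ∫⁻ x, ρ (γ₀ x) ∂((L : ℝ≥0∞) • (volume.restrict s).map V) := lintegral_mono' hle le_rfl
    _ = L * ∫⁻ x, ρ (γ₀ x) ∂((volume.restrict s).map V) := by
      rw [lintegral_smul_measure, smul_eq_mul]
    _ ≤ L * ∫⁻ t in s, ρ (γ₀ (V t)) := by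
      exact mul_le_mul_right (lintegral_map_le (fun x => ρ (γ₀ x)) V) _
    _ = L * ∫⁻ t in s, ρ (γ.toFun t) := by
      congr 1
      refine setLIntegral_congr_fun measurableSet_Icc fun t ht => ?_
      simp only [hγ₀, hV, edist_eq_zero.1 (edist_naturalParameterization_eq_zero hbv ha ht)]

/-! ### Broken lines projected to a sphere. -/

/-- The radial projection to the unit sphere. -/
noncomputable def radial {n : ℕ} (w : Rn n) : Rn n := ‖w‖⁻¹ • w

theorem measurable_radial {n : ℕ} : Measurable (radial (n := n)) := by
  unfold radial
  fun_prop

theorem radial_smul_of_norm_eq_one {n : ℕ} {r : ℝ} (hr : 0 < r) {θ : Rn n} (hθ : ‖θ‖ = 1) :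
    radial (r • θ) = θ := by
  rw [radial, norm_smul, hθ, mul_one, Real.norm_of_nonneg hr.le, inv_smul_smul₀ hr.ne']

theorem radial_of_norm_eq_one {n : ℕ} {θ : Rn n} (hθ : ‖θ‖ = 1) : radial θ = θ := by
  simp [radial, hθ]

theorem norm_radial_sub_le {n : ℕ} {w w' : Rn n} (hw : 2 / 5 ≤ ‖w‖) (hw' : 2 / 5 ≤ ‖w'‖) :
    ‖radial w - radial w'‖ ≤ 5 * ‖w - w'‖ := by
  have h0 : 0 < ‖w‖ := by linarith
  have h0' : 0 < ‖w'‖ := by linarith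
  have h1 : radial w - radial w' = ‖w‖⁻¹ • (w - w') + (‖w‖⁻¹ - ‖w'‖⁻¹) • w' := by
    simp only [radial]
    module
  have h2 : ‖w‖⁻¹ ≤ 5 / 2 := by
    rw [inv_le_comm₀ h0 (by norm_num)]
    linarith
  have h3 : |‖w‖⁻¹ - ‖w'‖⁻¹| * ‖w'‖ = |‖w'‖ - ‖w‖| * ‖w‖⁻¹ := by
    have : ‖w‖⁻¹ - ‖w'‖⁻¹ = (‖w'‖ - ‖w‖) * (‖w‖⁻¹ * ‖w'‖⁻¹) := by field_simp
    rw [this, abs_mul, abs_of_pos (by positivity : 0 < ‖w‖⁻¹ * ‖w'‖⁻¹)]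
    field_simp
  have h4 : |‖w'‖ - ‖w‖| ≤ ‖w - w'‖ := by
    rw [norm_sub_rev]
    exact abs_norm_sub_norm_le w' w
  rw [h1]
  refine (norm_add_le _ _).trans ?_
  rw [norm_smul, norm_smul, Real.norm_of_nonneg (by positivity), Real.norm_eq_abs, h3]
  nlinarith [mul_le_mul h4 h2 (by positivity) (norm_nonneg (w - w')),
    mul_le_mul_of_nonneg_right h2 (norm_nonneg (w - w'))]

/-- The angle condition keeps `[c, u]` at distance at least `1/√2 > 7/10` from the origin, and
replacing `u` by `z` costs at most `1/4`. -/
theorem two_fifths_le_norm_segment {n : ℕ} {c u z : Rn n} (hc : ‖c‖ = 1) (hu : ‖u‖ = 1)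
    (hcu : 0 ≤ inner ℝ c u) (hz : ‖z - u‖ < 1 / 4) {t : ℝ} (ht : t ∈ Icc (0 : ℝ) 1) :
    2 / 5 ≤ ‖(1 - t) • c + t • z‖ := by
  obtain ⟨h0, h1⟩ := ht
  have h2 : ‖(1 - t) • c + t • u‖ ^ 2 = (1 - t) ^ 2 + 2 * ((1 - t) * (t * inner ℝ c u)) + t ^ 2 := by
    rw [norm_add_sq_real, norm_smul, norm_smul, hc, hu, real_inner_smul_left,
      real_inner_smul_right, Real.norm_of_nonneg (by linarith), Real.norm_of_nonneg h0]
    ring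
  have h3 : 0 ≤ (1 - t) * (t * inner ℝ c u) := mul_nonneg (by linarith) (mul_nonneg h0 hcu)
  have h4 : (7 / 10 : ℝ) ≤ ‖(1 - t) • c + t • u‖ := by
    refine le_of_sq_le_sq ?_ (norm_nonneg _)
    nlinarith [sq_nonneg (2 * t - 1)]
  have h5 : (1 - t) • c + t • u = ((1 - t) • c + t • z) - t • (z - u) := by module
  have h6 : ‖t • (z - u)‖ ≤ 1 / 4 := by
    rw [norm_smul, Real.norm_of_nonneg h0]
    nlinarith [norm_nonneg (z - u)]
  have h7 := norm_sub_le ((1 - t) • c + t • z) (t • (z - u))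
  rw [← h5] at h7
  linarith

/-- The broken line from `c` through `z` to `k`, parametrized by `[0, 2]`. -/
noncomputable def brokenLine {n : ℕ} (c z k : Rn n) (t : ℝ) : Rn n :=
  c + min t 1 • (z - c) + max (t - 1) 0 • (k - z)

theorem brokenLine_of_le {n : ℕ} (c z k : Rn n) {t : ℝ} (ht : t ≤ 1) :
    brokenLine c z k t = (1 - t) • c + t • z := by
  rw [brokenLine, min_eq_left ht, max_eq_right (by linarith)]
  module

/-- Time reversal exchanges `c` and `k`, so estimates on the first half also give the second. -/
theorem brokenLine_two_sub_of_le {n : ℕ} (c z k : Rn n) {t : ℝ} (ht : t ≤ 1) :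
    brokenLine c z k (2 - t) = (1 - t) • k + t • z := by
  rw [brokenLine, min_eq_right (by linarith), max_eq_left (by linarith)]
  module

theorem norm_brokenLine_sub_le {n : ℕ} {c z k : Rn n} (h₁ : ‖z - c‖ ≤ 3) (h₂ : ‖k - z‖ ≤ 3)
    (s t : ℝ) : ‖brokenLine c z k s - brokenLine c z k t‖ ≤ 6 * |s - t| := by
  have h : brokenLine c z k s - brokenLine c z k t =
      (min s 1 - min t 1) • (z - c) + (max (s - 1) 0 - max (t - 1) 0) • (k - z) := by
    simp only [brokenLine]
    module
  have h3 : |min s 1 - min t 1| ≤ |s - t| := by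
    simpa using abs_min_sub_min_le_max s 1 t 1
  have h4 : |max (s - 1) 0 - max (t - 1) 0| ≤ |s - t| := by
    simpa using abs_max_sub_max_le_max (s - 1) 0 (t - 1) 0
  rw [h]
  refine (norm_add_le _ _).trans ?_
  rw [norm_smul, norm_smul, Real.norm_eq_abs, Real.norm_eq_abs]
  nlinarith [mul_le_mul h3 h₁ (norm_nonneg _) (abs_nonneg _),
    mul_le_mul h4 h₂ (norm_nonneg _) (abs_nonneg _)]

theorem two_fifths_le_norm_brokenLine {n : ℕ} {c u z k : Rn n} (hc : ‖c‖ = 1) (hk : ‖k‖ = 1)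
    (hu : ‖u‖ = 1) (hcu : 0 ≤ inner ℝ c u) (hku : 0 ≤ inner ℝ k u) (hz : ‖z - u‖ < 1 / 4) {t : ℝ}
    (ht : t ∈ Icc (0 : ℝ) 2) : 2 / 5 ≤ ‖brokenLine c z k t‖ := by
  rcases le_total t 1 with h | h
  · rw [brokenLine_of_le c z k h]
    exact two_fifths_le_norm_segment hc hu hcu hz ⟨ht.1, h⟩
  · have := brokenLine_two_sub_of_le c z k (t := 2 - t) (by linarith)
    rw [sub_sub_cancel] at this
    rw [this]
    exact two_fifths_le_norm_segment hk hu hku hz ⟨by linarith [ht.2], by linarith⟩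

/-- The projection of a broken line to the sphere `S(x₀, r)` is Lipschitz. -/
theorem lipschitzOnWith_radial_brokenLine {n : ℕ} {c u z k : Rn n} (hc : ‖c‖ = 1) (hk : ‖k‖ = 1)
    (hu : ‖u‖ = 1) (hcu : 0 ≤ inner ℝ c u) (hku : 0 ≤ inner ℝ k u) (hz : ‖z - u‖ < 1 / 4)
    (x₀ : Rn n) {r : ℝ} (hr : 0 < r) :
    LipschitzOnWith (Real.toNNReal (30 * r)) (fun t => x₀ + r • radial (brokenLine c z k t))
      (Icc 0 2) := by
  have hzn : ‖z‖ ≤ 5 / 4 := by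
    have := norm_add_le (z - u) u
    rw [sub_add_cancel, hu] at this
    linarith
  have h1 : ‖z - c‖ ≤ 3 := (norm_sub_le _ _).trans (by linarith)
  have h2 : ‖k - z‖ ≤ 3 := (norm_sub_le _ _).trans (by linarith)
  refine LipschitzOnWith.of_dist_le_mul fun s hs t ht => ?_
  rw [Real.coe_toNNReal _ (by positivity), dist_add_left, dist_eq_norm, ← smul_sub, norm_smul,
    Real.norm_of_nonneg hr.le, Real.dist_eq]
  have h3 := norm_radial_sub_le (two_fifths_le_norm_brokenLine hc hk hu hcu hku hz hs)
    (two_fifths_le_norm_brokenLine hc hk hu hcu hku hz ht)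
  have h4 := norm_brokenLine_sub_le h1 h2 s t
  nlinarith

theorem lintegral_brokenLine {n : ℕ} (F : Rn n → ℝ≥0∞) (c z k : Rn n) :
    ∫⁻ t in Icc (0 : ℝ) 2, F (brokenLine c z k t) ≤
      (∫⁻ t in Ioo (0 : ℝ) 1, F ((1 - t) • c + t • z)) +
        ∫⁻ t in Ioo (0 : ℝ) 1, F ((1 - t) • k + t • z) := by
  have h1 : ∫⁻ t in Ioo (0 : ℝ) 1, F ((1 - t) • c + t • z) =
      ∫⁻ t in Icc (0 : ℝ) 1, F (brokenLine c z k t) := by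
    rw [← restrict_Ioo_eq_restrict_Icc]
    exact setLIntegral_congr_fun measurableSet_Ioo fun t ht => by
      simp only [brokenLine_of_le c z k ht.2.le]
  have h2 : ∫⁻ t in Ioo (0 : ℝ) 1, F ((1 - t) • k + t • z) =
      ∫⁻ t in Icc (1 : ℝ) 2, F (brokenLine c z k t) := by
    rw [← restrict_Ioo_eq_restrict_Icc]
    have hmp : MeasurePreserving (fun t : ℝ => 2 - t) volume volume :=
      Measure.measurePreserving_sub_left volume 2
    have he : MeasurableEmbedding (fun t : ℝ => 2 - t) :=
      (MeasurableEquiv.subLeft (2 : ℝ)).measurableEmbedding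
    rw [← hmp.setLIntegral_comp_preimage_emb he (fun t => F (brokenLine c z k t))]
    have : (fun t : ℝ => 2 - t) ⁻¹' Ioo 1 2 = Ioo 0 1 := by
      ext t
      simp only [mem_preimage, mem_Ioo]
      constructor <;> rintro ⟨h, h'⟩ <;> constructor <;> linarith
    rw [this]
    exact setLIntegral_congr_fun measurableSet_Ioo fun t ht => by
      simp only [brokenLine_two_sub_of_le c z k ht.2.le]
  rw [h1, h2, ← Icc_union_Icc_eq_Icc (zero_le_one' ℝ) one_le_two]
  exact lintegral_union_le _ _ _

/-! ### Energy bounds by averaging over curves. -/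

/-- The integral over a small ball of a function constant on rays is controlled by its integral
over the unit sphere, with the radius of the ball as a factor. -/
theorem setLIntegral_ball_radial_le {n : ℕ} (hn : 1 ≤ n) {h : Rn n → ℝ≥0∞} (hh : Measurable h)
    {q : Rn n} (hq : ‖q‖ ≤ 1) {s : ℝ} (hs : s ≤ 1) :
    ∫⁻ w in Metric.ball q s, h (radial w) ≤
      ENNReal.ofReal (2 ^ n * s) * ∫⁻ θ, h θ.1 ∂sphereMeasure n := by
  have hm : Measurable ((Metric.ball q s).indicator fun w => h (radial w)) :=
    (hh.comp measurable_radial).indicator Metric.isOpen_ball.measurableSet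
  set H := ∫⁻ θ, h θ.1 ∂sphereMeasure n
  rw [← lintegral_indicator Metric.isOpen_ball.measurableSet, lintegral_polar hn hm 0]
  calc _ ≤ ∫⁻ r in Ioi (0 : ℝ), (Ioo (‖q‖ - s) (‖q‖ + s)).indicator
        (fun _ => ENNReal.ofReal (2 ^ (n - 1)) * H) r := by
        refine setLIntegral_mono' measurableSet_Ioi fun r hr => ?_
        have hr0 : (0 : ℝ) < r := hr
        have hmem : ∀ θ : Metric.sphere (0 : Rn n) 1, 0 + r • θ.1 ∈ Metric.ball q s →
            r ∈ Ioo (‖q‖ - s) (‖q‖ + s) := by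
          intro θ hθ
          have h1 : ‖r • θ.1‖ = r := by simp [norm_smul, abs_of_pos hr0]
          rw [zero_add, Metric.mem_ball, dist_eq_norm] at hθ
          have h2 := (abs_norm_sub_norm_le (r • θ.1) q).trans_lt hθ
          rw [h1, abs_lt] at h2
          exact ⟨by linarith [h2.1], by linarith [h2.2]⟩
        by_cases hrI : r ∈ Ioo (‖q‖ - s) (‖q‖ + s)
        · rw [indicator_of_mem hrI]
          refine mul_le_mul' (ENNReal.ofReal_le_ofReal ?_) (lintegral_mono fun θ => ?_)
          · exact pow_le_pow_left₀ hr0.le (by linarith [hrI.2]) _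
          · refine (indicator_le_self _ _ _).trans_eq ?_
            rw [zero_add, radial_smul_of_norm_eq_one hr0 (by simp)]
        · rw [indicator_of_notMem hrI]
          have : ∀ θ : Metric.sphere (0 : Rn n) 1,
              (Metric.ball q s).indicator (fun w => h (radial w)) (0 + r • θ.1) = 0 :=
            fun θ => indicator_of_notMem (fun hθ => hrI (hmem θ hθ)) _
          rw [lintegral_congr this, lintegral_zero, mul_zero]
    _ ≤ ENNReal.ofReal (2 ^ (n - 1)) * H * volume (Ioo (‖q‖ - s) (‖q‖ + s)) := by
        rw [lintegral_indicator_const measurableSet_Ioo]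
        gcongr
        exact Measure.restrict_le_self
    _ = _ := by
        rw [Real.volume_Ioo, mul_right_comm, ← ENNReal.ofReal_mul (by positivity)]
        congr 2
        obtain ⟨k, rfl⟩ : ∃ k, n = k + 1 := ⟨n - 1, by omega⟩
        simp only [add_tsub_cancel_right]
        ring

theorem lintegral_comp_add_smul {n : ℕ} {F : Rn n → ℝ≥0∞} (hF : Measurable F) (c : Rn n) {t : ℝ}
    (ht : 0 < t) : ∫⁻ z, F (c + t • z) = ENNReal.ofReal ((t ^ n)⁻¹) * ∫⁻ w, F w := by
  have hm : Measurable fun z : Rn n => t • z := by fun_prop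
  rw [← lintegral_map (f := fun w => F (c + w)) (hF.comp (by fun_prop)) hm,
    Measure.map_addHaar_smul _ ht.ne', lintegral_smul_measure, lintegral_add_left_eq_self F c,
    finrank_euclideanSpace_fin, abs_of_pos (by positivity), smul_eq_mul]

/-- The substitution `w = (1 - t) c + t z` costs `t⁻ⁿ` and lands in a ball of radius `t`. Constancy
of the integrand on rays gives back one factor `t`, leaving `t ^ (-(n - 1))`. -/
theorem setLIntegral_ball_radial_segment_le {n : ℕ} (hn : 1 ≤ n) {h : Rn n → ℝ≥0∞}
    (hh : Measurable h) {c u : Rn n} (hc : ‖c‖ = 1) (hu : ‖u‖ = 1) {t : ℝ} (ht : t ∈ Ioo (0 : ℝ) 1) :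
    ∫⁻ z in Metric.ball u (1 / 4), h (radial ((1 - t) • c + t • z)) ≤
      ENNReal.ofReal (2 ^ n * (t ^ (n - 1))⁻¹) * ∫⁻ θ, h θ.1 ∂sphereMeasure n := by
  obtain ⟨ht0, ht1⟩ := ht
  set q := (1 - t) • c + t • u with hq
  have hqn : ‖q‖ ≤ 1 := by
    refine (norm_add_le _ _).trans ?_
    rw [norm_smul, norm_smul, hc, hu, Real.norm_of_nonneg (by linarith), Real.norm_of_nonneg ht0.le]
    linarith
  have hm : Measurable ((Metric.ball q t).indicator fun w => h (radial w)) :=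
    (hh.comp measurable_radial).indicator Metric.isOpen_ball.measurableSet
  calc _ ≤ ∫⁻ z in Metric.ball u (1 / 4),
        (Metric.ball q t).indicator (fun w => h (radial w)) ((1 - t) • c + t • z) := by
        refine setLIntegral_mono' Metric.isOpen_ball.measurableSet fun z hz => ?_
        rw [indicator_of_mem]
        rw [Metric.mem_ball, dist_eq_norm] at hz ⊢
        have : (1 - t) • c + t • z - q = t • (z - u) := by rw [hq]; module
        rw [this, norm_smul, Real.norm_of_nonneg ht0.le]
        nlinarith
    _ ≤ _ := setLIntegral_le_lintegral _ _
    _ = ENNReal.ofReal ((t ^ n)⁻¹) * ∫⁻ w in Metric.ball q t, h (radial w) := by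
        rw [lintegral_comp_add_smul hm _ ht0, lintegral_indicator Metric.isOpen_ball.measurableSet]
    _ ≤ ENNReal.ofReal ((t ^ n)⁻¹) *
        (ENNReal.ofReal (2 ^ n * t) * ∫⁻ θ, h θ.1 ∂sphereMeasure n) := by
        gcongr
        exact setLIntegral_ball_radial_le hn hh hqn ht1.le
    _ = _ := by
        rw [← mul_assoc, ← ENNReal.ofReal_mul (by positivity)]
        congr 2
        obtain ⟨k, rfl⟩ : ∃ k, n = k + 1 := ⟨n - 1, by omega⟩
        simp only [add_tsub_cancel_right]
        field_simp
        ring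

/-- A substitute for Hölder's inequality: the free threshold `l` can be adapted to the parameter on
the segment. -/
theorem ennreal_le_add_mul_pow {n : ℕ} (hn : 1 ≤ n) (x : ℝ≥0∞) {l : ℝ} (hl : 0 < l) :
    x ≤ ENNReal.ofReal l + ENNReal.ofReal ((l ^ (n - 1))⁻¹) * x ^ n := by
  rcases le_total x (ENNReal.ofReal l) with h | h
  · exact h.trans le_self_add
  · refine le_trans ?_ le_add_self
    have h1 : ENNReal.ofReal ((l ^ (n - 1))⁻¹) * ENNReal.ofReal l ^ (n - 1) = 1 := by
      rw [← ENNReal.ofReal_pow hl.le, ← ENNReal.ofReal_mul (by positivity),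
        inv_mul_cancel₀ (by positivity), ENNReal.ofReal_one]
    calc x = ENNReal.ofReal ((l ^ (n - 1))⁻¹) * (ENNReal.ofReal l ^ (n - 1) * x) := by
          rw [← mul_assoc, h1, one_mul]
      _ ≤ ENNReal.ofReal ((l ^ (n - 1))⁻¹) * (x ^ (n - 1) * x) := by gcongr
      _ = _ := by rw [← pow_succ, Nat.sub_add_cancel hn]

/-- The average over `z` of the integrals of `g` along the projections of the segments `[c, z]`. -/
theorem lintegral_radial_segments_le {n : ℕ} (hn : 1 ≤ n) {g : Rn n → ℝ≥0∞} (hg : Measurable g)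
    {c u : Rn n} (hc : ‖c‖ = 1) (hu : ‖u‖ = 1) {ε : ℝ} (hε : 0 < ε) :
    ∫⁻ z in Metric.ball u (1 / 4), ∫⁻ t in Ioo (0 : ℝ) 1, g (radial ((1 - t) • c + t • z)) ≤
      (∫⁻ t in Ioo (0 : ℝ) 1, ENNReal.ofReal (t ^ (-1 + (n : ℝ)⁻¹))) *
        (ENNReal.ofReal ε * volume (Metric.ball (0 : Rn n) (1 / 4)) +
          ENNReal.ofReal ((ε ^ (n - 1))⁻¹ * 2 ^ n) * ∫⁻ θ, g θ.1 ^ n ∂sphereMeasure n) := by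
  have hn0 : (n : ℝ) ≠ 0 := by positivity
  set K := ENNReal.ofReal ε * volume (Metric.ball (0 : Rn n) (1 / 4)) +
          ENNReal.ofReal ((ε ^ (n - 1))⁻¹ * 2 ^ n) * ∫⁻ θ, g θ.1 ^ n ∂sphereMeasure n with hK
  have hm : Measurable fun p : Rn n × ℝ => g (radial ((1 - p.2) • c + p.2 • p.1)) :=
    hg.comp (measurable_radial.comp (by fun_prop))
  rw [lintegral_lintegral_swap hm.aemeasurable,
    ← lintegral_mul_const _ (by fun_prop)]
  refine setLIntegral_mono' measurableSet_Ioo fun t ht => ?_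
  have ht0 : 0 < t := ht.1
  -- This power of `t` makes both terms multiples of `t ^ (-1 + 1/n)`, which is integrable at `0`.
  set l := ε * t ^ (-1 + (n : ℝ)⁻¹) with hl
  have hl0 : 0 < l := by positivity
  have hexp : (l ^ (n - 1))⁻¹ * (2 ^ n * (t ^ (n - 1))⁻¹) =
      t ^ (-1 + (n : ℝ)⁻¹) * ((ε ^ (n - 1))⁻¹ * 2 ^ n) := by
    have h1 : (t ^ (-1 + (n : ℝ)⁻¹)) ^ (n - 1) * t ^ (n - 1) = (t ^ (-1 + (n : ℝ)⁻¹))⁻¹ := by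
      rw [← mul_pow, ← Real.rpow_natCast, ← Real.rpow_add_one ht0.ne', ← Real.rpow_mul ht0.le,
        ← Real.rpow_neg ht0.le, Nat.cast_sub hn]
      congr 1
      field_simp
      push_cast
      ring
    rw [hl, mul_pow]
    have h2 : t ^ (-1 + (n : ℝ)⁻¹) = ((t ^ (-1 + (n : ℝ)⁻¹)) ^ (n - 1) * t ^ (n - 1))⁻¹ := by
      rw [h1, inv_inv]
    conv_rhs => rw [h2]
    rw [mul_inv, mul_inv]
    ring
  calc ∫⁻ z in Metric.ball u (1 / 4), g (radial ((1 - t) • c + t • z))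
      ≤ ∫⁻ z in Metric.ball u (1 / 4), (ENNReal.ofReal l +
          ENNReal.ofReal ((l ^ (n - 1))⁻¹) * g (radial ((1 - t) • c + t • z)) ^ n) :=
        lintegral_mono fun z => ennreal_le_add_mul_pow hn _ hl0
    _ = ENNReal.ofReal l * volume (Metric.ball (0 : Rn n) (1 / 4)) +
        ENNReal.ofReal ((l ^ (n - 1))⁻¹) *
          ∫⁻ z in Metric.ball u (1 / 4), g (radial ((1 - t) • c + t • z)) ^ n := by
        rw [lintegral_add_left measurable_const, setLIntegral_const,
          Measure.addHaar_ball_center, lintegral_const_mul' _ _ ENNReal.ofReal_ne_top]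
    _ ≤ ENNReal.ofReal l * volume (Metric.ball (0 : Rn n) (1 / 4)) +
        ENNReal.ofReal ((l ^ (n - 1))⁻¹) * (ENNReal.ofReal (2 ^ n * (t ^ (n - 1))⁻¹) *
          ∫⁻ θ, g θ.1 ^ n ∂sphereMeasure n) := by
        gcongr
        exact setLIntegral_ball_radial_segment_le hn (hg.pow_const n) hc hu ht
    _ = ENNReal.ofReal (t ^ (-1 + (n : ℝ)⁻¹)) * K := by
        rw [← mul_assoc, ← ENNReal.ofReal_mul (by positivity), hexp,
          ENNReal.ofReal_mul hε.le, ENNReal.ofReal_mul (p := t ^ _) (by positivity), hK]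
        ring

theorem lintegral_rpow_lt_top {n : ℕ} (hn : 1 ≤ n) :
    ∫⁻ t in Ioo (0 : ℝ) 1, ENNReal.ofReal (t ^ (-1 + (n : ℝ)⁻¹)) < ∞ := by
  have h : IntegrableOn (fun t : ℝ => t ^ (-1 + (n : ℝ)⁻¹)) (Ioo 0 1) := by
    have := intervalIntegral.intervalIntegrable_rpow' (a := 0) (b := 1) (r := -1 + (n : ℝ)⁻¹)
      (by have : (0 : ℝ) < (n : ℝ)⁻¹ := by positivity
          linarith)
    rw [intervalIntegrable_iff_integrableOn_Ioo_of_le zero_le_one] at this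
    exact this
  exact h.lintegral_lt_top

/-- As `n ≥ 2`, some unit vector is orthogonal to `c`; its sign is free and is chosen to suit `k`.
This also covers antipodal `c` and `k`. -/
theorem exists_unit_inner_nonneg {n : ℕ} (hn : 2 ≤ n) (c k : Rn n) :
    ∃ u : Rn n, ‖u‖ = 1 ∧ 0 ≤ inner ℝ c u ∧ 0 ≤ inner ℝ k u := by
  obtain ⟨v, hv, hv1⟩ : ∃ v : Rn n, inner ℝ c v = 0 ∧ ‖v‖ = 1 := by
    have h1 : Module.finrank ℝ (Submodule.span ℝ {c}) ≤ 1 := by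
      simpa using finrank_span_le_card (R := ℝ) ({c} : Set (Rn n))
    have h2 := (Submodule.span ℝ {c}).finrank_add_finrank_orthogonal
    rw [finrank_euclideanSpace_fin] at h2
    have h3 : 0 < Module.finrank ℝ (Submodule.span ℝ {c})ᗮ := by omega
    have : Nontrivial (Submodule.span ℝ {c})ᗮ := Module.nontrivial_of_finrank_pos h3
    obtain ⟨v, hv⟩ := exists_norm_eq (Submodule.span ℝ {c})ᗮ (zero_le_one' ℝ)
    exact ⟨v, Submodule.mem_orthogonal_singleton_iff_inner_right.1 v.2, hv⟩
  rcases le_total 0 (inner ℝ k v) with h | h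
  · exact ⟨v, hv1, hv.ge, h⟩
  · exact ⟨-v, by simpa using hv1, by simp [hv], by simpa using h⟩

/-- Lower bound for the `n`-energy on the sphere of a function whose integral along every Lipschitz
path joining two given points of the sphere is at least `1`. -/
theorem exists_sphere_energy_bound {n : ℕ} (hn : 2 ≤ n) : ∃ C : ℝ≥0∞, C ≠ 0 ∧
    ∀ (ρ : Rn n → ℝ≥0∞) (x₀ : Rn n) (r : ℝ) (c k : Rn n), Measurable ρ → 0 < r →
      c ∈ Metric.sphere x₀ r → k ∈ Metric.sphere x₀ r →
      (∀ (γ : ℝ → Rn n) (L : ℝ≥0), LipschitzOnWith L γ (Icc 0 2) → γ 0 = c → γ 2 = k →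
        1 ≤ L * ∫⁻ t in Icc (0 : ℝ) 2, ρ (γ t)) →
      C ≤ ∫⁻ θ, (ENNReal.ofReal r * ρ (x₀ + r • θ.1)) ^ n ∂sphereMeasure n := by
  have hn1 : 1 ≤ n := by omega
  set J := ∫⁻ t in Ioo (0 : ℝ) 1, ENNReal.ofReal (t ^ (-1 + (n : ℝ)⁻¹)) with hJ
  have hJtop : J ≠ ∞ := (lintegral_rpow_lt_top hn1).ne
  set V := volume (Metric.ball (0 : Rn n) (1 / 4)) with hV
  have hV0 : V ≠ 0 := (Metric.measure_ball_pos _ _ (by norm_num)).ne'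
  have hVtop : V ≠ ∞ := measure_ball_lt_top.ne
  -- Small enough that the term with `ε` contributes at most `V / 2` and can be absorbed on the
  -- left.
  set ε : ℝ := (120 * (J.toReal + 1))⁻¹ with hε
  have hJ0 : 0 ≤ J.toReal := ENNReal.toReal_nonneg
  have hε0 : 0 < ε := by positivity
  have hεJ : 60 * J * ENNReal.ofReal ε ≤ 2⁻¹ := by
    rw [← ENNReal.ofReal_toReal hJtop, ← ENNReal.ofReal_ofNat 60,
      ← ENNReal.ofReal_mul (by norm_num), ← ENNReal.ofReal_mul (by positivity),
      ← ENNReal.ofReal_ofNat 2, ← ENNReal.ofReal_inv_of_pos (by norm_num)]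
    refine ENNReal.ofReal_le_ofReal ?_
    rw [hε, ← div_eq_mul_inv, div_le_iff₀ (by positivity)]
    linarith
  set B := ENNReal.ofReal ((ε ^ (n - 1))⁻¹ * 2 ^ n) with hB
  refine ⟨V / 2 / (60 * J * B), ?_, ?_⟩
  · refine (ENNReal.div_pos (ENNReal.div_pos hV0 (by simp)).ne' ?_).ne'
    exact ENNReal.mul_ne_top (ENNReal.mul_ne_top (by simp) hJtop) ENNReal.ofReal_ne_top
  intro ρ x₀ r c k hρ hr hc hk hpath
  set g : Rn n → ℝ≥0∞ := fun θ => ENNReal.ofReal r * ρ (x₀ + r • θ) with hg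
  have hgm : Measurable g := measurable_const.mul (hρ.comp (by fun_prop))
  set G := ∫⁻ θ, g θ.1 ^ n ∂sphereMeasure n with hG
  have hunit : ∀ {x : Rn n}, x ∈ Metric.sphere x₀ r → ‖r⁻¹ • (x - x₀)‖ = 1 := by
    intro x hx
    rw [mem_sphere_iff_norm] at hx
    rw [norm_smul, hx, Real.norm_of_nonneg (by positivity), inv_mul_cancel₀ hr.ne']
  set c' := r⁻¹ • (c - x₀) with hc'
  set k' := r⁻¹ • (k - x₀) with hk'
  have hc1 : ‖c'‖ = 1 := hunit hc
  have hk1 : ‖k'‖ = 1 := hunit hk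
  obtain ⟨u, hu, hcu, hku⟩ := exists_unit_inner_nonneg hn c' k'
  have hz : ∀ z ∈ Metric.ball u (1 / 4), 1 ≤ 30 *
      ((∫⁻ t in Ioo (0 : ℝ) 1, g (radial ((1 - t) • c' + t • z))) +
        ∫⁻ t in Ioo (0 : ℝ) 1, g (radial ((1 - t) • k' + t • z))) := by
    intro z hz
    rw [Metric.mem_ball, dist_eq_norm] at hz
    have hlip := lipschitzOnWith_radial_brokenLine hc1 hk1 hu hcu hku hz x₀ hr
    have h1 := hpath _ _ hlip
      (by rw [brokenLine_of_le _ _ _ zero_le_one, sub_zero, one_smul, zero_smul, add_zero,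
            radial_of_norm_eq_one hc1, hc', smul_inv_smul₀ hr.ne', add_sub_cancel])
      (by have := brokenLine_two_sub_of_le c' z k' zero_le_one
          rw [sub_zero, sub_zero, one_smul, zero_smul, add_zero] at this
          rw [this, radial_of_norm_eq_one hk1, hk', smul_inv_smul₀ hr.ne', add_sub_cancel])
    refine h1.trans ?_
    have h2 : (Real.toNNReal (30 * r) : ℝ≥0∞) = 30 * ENNReal.ofReal r := by
      change ENNReal.ofReal (30 * r) = _
      rw [ENNReal.ofReal_mul (by norm_num), ENNReal.ofReal_ofNat]
    rw [h2, mul_assoc, ← lintegral_const_mul' _ _ ENNReal.ofReal_ne_top]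
    exact mul_le_mul_right (lintegral_brokenLine (fun w => g (radial w)) c' z k') _
  have hmeas : ∀ p : Rn n, Measurable fun z : Rn n =>
      ∫⁻ t in Ioo (0 : ℝ) 1, g (radial ((1 - t) • p + t • z)) := by
    intro p
    have : Measurable fun q : Rn n × ℝ => g (radial ((1 - q.2) • p + q.2 • q.1)) :=
      hgm.comp (measurable_radial.comp (by fun_prop))
    exact this.lintegral_prod_right'
  -- Averaging over `z`; the two halves of the broken line each carry the Lipschitz factor `30`.
  have hintegral : V ≤ 60 * (J * (ENNReal.ofReal ε * V + B * G)) := by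
    calc V = ∫⁻ _z in Metric.ball u (1 / 4), 1 := by
          rw [setLIntegral_one, Measure.addHaar_ball_center]
      _ ≤ ∫⁻ z in Metric.ball u (1 / 4), 30 *
          ((∫⁻ t in Ioo (0 : ℝ) 1, g (radial ((1 - t) • c' + t • z))) +
            ∫⁻ t in Ioo (0 : ℝ) 1, g (radial ((1 - t) • k' + t • z))) :=
          setLIntegral_mono' Metric.isOpen_ball.measurableSet hz
      _ = 30 * ((∫⁻ z in Metric.ball u (1 / 4),
            ∫⁻ t in Ioo (0 : ℝ) 1, g (radial ((1 - t) • c' + t • z))) +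
          ∫⁻ z in Metric.ball u (1 / 4),
            ∫⁻ t in Ioo (0 : ℝ) 1, g (radial ((1 - t) • k' + t • z))) := by
          rw [lintegral_const_mul' _ _ (by simp), lintegral_add_left (hmeas c')]
      _ ≤ 30 * (J * (ENNReal.ofReal ε * V + B * G) + J * (ENNReal.ofReal ε * V + B * G)) := by
          gcongr
          · exact lintegral_radial_segments_le hn1 hgm hc1 hu hε0
          · exact lintegral_radial_segments_le hn1 hgm hk1 hu hε0
      _ = _ := by ring
  have hfin : V / 2 ≤ 60 * J * B * G := by
    have h1 : V / 2 + V / 2 ≤ V / 2 + 60 * J * B * G := by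
      rw [ENNReal.add_halves]
      calc V ≤ 60 * (J * (ENNReal.ofReal ε * V + B * G)) := hintegral
        _ = 60 * J * ENNReal.ofReal ε * V + 60 * J * B * G := by ring
        _ ≤ 2⁻¹ * V + 60 * J * B * G := by gcongr
        _ = _ := by rw [mul_comm, ← div_eq_mul_inv]
    exact (ENNReal.add_le_add_iff_left (ENNReal.div_ne_top hVtop (by simp))).1 h1
  exact ENNReal.div_le_of_le_mul' hfin

/-- Lower bound for the `n`-energy of a function whose integral is at least `1` along every
Lipschitz path joining, in the sphere `S(x₀, r)`, two suitable points depending on `r ∈ (a, b)`. -/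
theorem exists_energy_bound {n : ℕ} (hn : 2 ≤ n) : ∃ C : ℝ≥0∞, C ≠ 0 ∧
    ∀ (ρ : Rn n → ℝ≥0∞) (x₀ : Rn n) (a b : ℝ), Measurable ρ → 0 < a → a < b →
      (∀ r ∈ Ioo a b, ∃ c ∈ Metric.sphere x₀ r, ∃ k ∈ Metric.sphere x₀ r,
        ∀ (γ : ℝ → Rn n) (L : ℝ≥0), LipschitzOnWith L γ (Icc 0 2) → γ 0 = c → γ 2 = k →
          1 ≤ L * ∫⁻ t in Icc (0 : ℝ) 2, ρ (γ t)) →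
      C * ENNReal.ofReal (Real.log (b / a)) ≤ ∫⁻ x, ρ x ^ n := by
  obtain ⟨C, hC, hbound⟩ := exists_sphere_energy_bound hn
  refine ⟨C, hC, fun ρ x₀ a b hρ ha hab h => ?_⟩
  have hlog : ∫⁻ r in Ioo a b, ENNReal.ofReal r⁻¹ = ENNReal.ofReal (Real.log (b / a)) := by
    have hintegral : IntervalIntegrable (fun r : ℝ => r⁻¹) volume a b := by
      refine intervalIntegral.intervalIntegrable_inv (fun r hr => ?_) continuousOn_id
      rw [uIcc_of_le hab.le] at hr
      exact (ha.trans_le hr.1).ne'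
    rw [← integral_inv_of_pos ha (ha.trans hab), intervalIntegral.integral_of_le hab.le,
      ← restrict_Ioo_eq_restrict_Ioc, ofReal_integral_eq_lintegral_ofReal]
    · exact (intervalIntegrable_iff_integrableOn_Ioo_of_le hab.le).1 hintegral
    · filter_upwards [ae_restrict_mem measurableSet_Ioo] with r hr
      exact inv_nonneg.2 (ha.trans hr.1).le
  calc C * ENNReal.ofReal (Real.log (b / a))
      = ∫⁻ r in Ioo a b, C * ENNReal.ofReal r⁻¹ := by
        rw [lintegral_const_mul _ (by fun_prop), hlog]
    _ ≤ ∫⁻ r in Ioo a b, ENNReal.ofReal (r ^ (n - 1)) *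
          ∫⁻ θ, ρ (x₀ + r • θ.1) ^ n ∂sphereMeasure n := by
        refine setLIntegral_mono' measurableSet_Ioo fun r hr => ?_
        have hr0 : 0 < r := ha.trans hr.1
        obtain ⟨c, hc, k, hk, hpath⟩ := h r hr
        have h1 := hbound ρ x₀ r c k hρ hr0 hc hk hpath
        -- The sphere bound carries `r ^ n` and the polar Jacobian only `r ^ (n - 1)`; the
        -- difference is the logarithmic density `1 / r`.
        simp only [mul_pow] at h1
        rw [lintegral_const_mul' _ _ (ENNReal.pow_ne_top ENNReal.ofReal_ne_top),
          ← ENNReal.ofReal_pow hr0.le] at h1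
        calc C * ENNReal.ofReal r⁻¹ ≤ _ := mul_le_mul_left h1 _
          _ = _ := by
            rw [mul_right_comm, ← ENNReal.ofReal_mul (by positivity)]
            congr 2
            obtain ⟨j, rfl⟩ : ∃ j, n = j + 1 := ⟨n - 1, by omega⟩
            simp only [add_tsub_cancel_right]
            field_simp
            ring
    _ ≤ ∫⁻ r in Ioi (0 : ℝ), ENNReal.ofReal (r ^ (n - 1)) *
          ∫⁻ θ, ρ (x₀ + r • θ.1) ^ n ∂sphereMeasure n :=
        lintegral_mono_set fun r hr => ha.trans hr.1
    _ = ∫⁻ x, ρ x ^ n := (lintegral_polar (by omega) (hρ.pow_const n) x₀).symm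

/-! ### Open closed mappings: properness and crossing paths. -/

/-- For an open closed mapping, the preimage of a connected set `F` that meets an open set `V` but
not its frontier has in `V` points over every point of `F`. -/
theorem subset_image_inter_of_isPreconnected {n : ℕ} {D F V : Set (Rn n)} {f : Rn n → Rn n}
    (hD : IsOpen D) (hopen : OpenMapOn D f) (hclosed : ClosedMapOn D f) (hF : IsPreconnected F)
    (hFD : F ⊆ f '' D) (hV : IsOpen V) (hfr : ∀ x ∈ D, f x ∈ F → x ∉ frontier V)
    {x : Rn n} (hx : x ∈ D) (hxV : x ∈ V) (hxF : f x ∈ F) : F ⊆ f '' (D ∩ V) := by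
  -- No point over `F` lies on the frontier of `V`, so the disjoint open sets `f '' (D ∩ V)` and
  -- `Cᶜ` cover `F`.
  obtain ⟨C, hC, hCeq⟩ := hclosed (closure V) isClosed_closure
  refine hF.subset_left_of_subset_union (hopen _ inter_subset_left (hD.inter hV)) hC.isOpen_compl
    ?_ ?_ ⟨f x, hxF, mem_image_of_mem f ⟨hx, hxV⟩⟩
  · refine disjoint_compl_right_iff_subset.2 ?_
    refine (image_mono (inter_subset_inter_right D subset_closure)).trans ?_
    rw [hCeq]
    exact inter_subset_right
  · intro y hy
    by_cases hyC : y ∈ C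
    · have : y ∈ f '' (D ∩ closure V) := hCeq ▸ ⟨hFD hy, hyC⟩
      obtain ⟨z, ⟨hzD, hzV⟩, rfl⟩ := this
      refine Or.inl (mem_image_of_mem f ⟨hzD, ?_⟩)
      by_contra hz
      exact hfr z hzD hy (hV.frontier_eq ▸ ⟨hzV, hz⟩)
    · exact Or.inr hyC

/-- An open mapping omits a given value at points arbitrarily close to a given point. -/
theorem exists_near_ne {n : ℕ} (hn : 1 ≤ n) {D : Set (Rn n)} {f : Rn n → Rn n}
    (hD : IsOpen D) (hf : ContinuousOn f D) (hopen : OpenMapOn D f) {x : Rn n} (hx : x ∈ D)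
    (y : Rn n) {ε : ℝ} (hε : 0 < ε) :
    ∃ x' ∈ D, dist x' x < ε ∧ dist (f x') (f x) < ε ∧ f x' ≠ y := by
  have : NeZero n := ⟨by omega⟩
  set U := D ∩ f ⁻¹' Metric.ball (f x) ε ∩ Metric.ball x ε with hU
  have hUo : IsOpen U := (hf.isOpen_inter_preimage hD Metric.isOpen_ball).inter Metric.isOpen_ball
  have hxU : x ∈ U := by simp [hU, hx, hε]
  have hfU : IsOpen (f '' U) := hopen U (fun z hz => hz.1.1) hUo
  have hnt : (f '' U).Nontrivial := by
    by_contra hnt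
    have hs : (f '' U).Subsingleton := not_nontrivial_iff.1 hnt
    rw [hs.eq_singleton_of_mem (mem_image_of_mem f hxU)] at hfU
    exact not_isOpen_singleton (f x) hfU
  obtain ⟨w, ⟨x', hx', rfl⟩, hne⟩ := hnt.exists_ne y
  exact ⟨x', hx'.1.1, hx'.2, hx'.1.2, hne⟩

/-- If `f : D → f(D)` is open and closed and `f(x k)` converges in `f(D)`, then `x` has a cluster
point in `D`. -/
theorem exists_mapClusterPt_of_tendsto {n : ℕ} (hn : 1 ≤ n) {D : Set (Rn n)} {f : Rn n → Rn n}
    (hD : IsOpen D) (hf : ContinuousOn f D) (hopen : OpenMapOn D f) (hclosed : ClosedMapOn D f)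
    {x : ℕ → Rn n} (hx : ∀ k, x k ∈ D) {y : Rn n} (hy : y ∈ f '' D)
    (hlim : Tendsto (fun k => f (x k)) atTop (𝓝 y)) : ∃ p ∈ D, MapClusterPt p atTop x := by
  by_contra! hcon
  -- The points are perturbed so that `f` never takes the value `y` on them; a preimage of `y` in
  -- the closure of the range must then be a genuine cluster point.
  choose x' hx'D hx'x hx'f hx'y using fun k : ℕ => exists_near_ne hn hD hf hopen (hx k) y
    (Nat.one_div_pos_of_nat (α := ℝ) (n := k))
  obtain ⟨C, hC, hCeq⟩ := hclosed (closure (range x')) isClosed_closure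
  have hsmall : Tendsto (fun k : ℕ => 1 / ((k : ℝ) + 1)) atTop (𝓝 0) :=
    tendsto_one_div_add_atTop_nhds_zero_nat
  have hlim' : Tendsto (fun k => f (x' k)) atTop (𝓝 y) := by
    refine hlim.congr_dist (squeeze_zero (fun _ => dist_nonneg) (fun k => ?_) hsmall)
    rw [dist_comm]
    exact (hx'f k).le
  have hyC : y ∈ C := by
    refine hC.mem_of_tendsto hlim' (Eventually.of_forall fun k => ?_)
    have : f (x' k) ∈ f '' (D ∩ closure (range x')) :=
      mem_image_of_mem f ⟨hx'D k, subset_closure (mem_range_self k)⟩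
    rw [hCeq] at this
    exact this.2
  have hyim : y ∈ f '' (D ∩ closure (range x')) := hCeq ▸ ⟨hy, hyC⟩
  obtain ⟨p, ⟨hpD, hpc⟩, hpy⟩ := hyim
  have hpcl := hcon p hpD
  rw [Metric.nhds_basis_ball.mapClusterPt_iff_frequently] at hpcl
  push Not at hpcl
  obtain ⟨ε, hε, hev⟩ := hpcl
  obtain ⟨N, hN⟩ := eventually_atTop.1
    (hev.and (hsmall.eventually (gt_mem_nhds (half_pos hε))))
  have hsub : range x' ⊆ x' '' Iio N ∪ (Metric.ball p (ε / 2))ᶜ := by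
    rintro _ ⟨k, rfl⟩
    rcases lt_or_ge k N with hk | hk
    · exact Or.inl (mem_image_of_mem x' hk)
    · refine Or.inr fun hkb => (hN k hk).1 ?_
      rw [Metric.mem_ball] at hkb ⊢
      have h1 := dist_triangle_left (x k) p (x' k)
      have h2 := hx'x k
      have h3 := (hN k hk).2
      linarith
  have hclosedset : IsClosed (x' '' Iio N ∪ (Metric.ball p (ε / 2))ᶜ) :=
    ((finite_Iio N).image x').isClosed.union Metric.isOpen_ball.isClosed_compl
  rcases closure_minimal hsub hclosedset hpc with ⟨k, -, rfl⟩ | h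
  · exact hx'y k hpy
  · exact h (Metric.mem_ball_self (half_pos hε))

/-- An open closed mapping is proper onto its image. -/
theorem isCompact_inter_preimage {n : ℕ} (hn : 1 ≤ n) {D : Set (Rn n)} {f : Rn n → Rn n}
    (hD : IsOpen D) (hf : ContinuousOn f D) (hopen : OpenMapOn D f) (hclosed : ClosedMapOn D f)
    {K : Set (Rn n)} (hK : IsCompact K) (hKD : K ⊆ f '' D) : IsCompact (D ∩ f ⁻¹' K) := by
  refine IsSeqCompact.isCompact fun x hx => ?_
  obtain ⟨y, hy, φ, hφ, hlim⟩ := hK.tendsto_subseq fun k => (hx k).2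
  obtain ⟨p, hp, hcl⟩ := exists_mapClusterPt_of_tendsto hn hD hf hopen hclosed
    (x := x ∘ φ) (fun k => (hx _).1) (hKD hy) hlim
  obtain ⟨ψ, hψ, hlim'⟩ := hcl.tendsto_subseq
  have h1 : Tendsto (fun k => f (x (φ (ψ k)))) atTop (𝓝 (f p)) :=
    (hf.continuousAt (hD.mem_nhds hp)).tendsto.comp hlim'
  have h2 : f p = y := tendsto_nhds_unique h1 (hlim.comp hψ.tendsto_atTop)
  exact ⟨p, ⟨hp, by rw [mem_preimage, h2]; exact hy⟩, φ ∘ ψ, hφ.comp hψ, hlim'⟩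

/-- `b` is the first time the level `r₂` is reached, and `a` the last time before `b` at level `r₁`.
-/
theorem exists_crossing {g : ℝ → ℝ} {s T r₁ r₂ : ℝ} (hsT : s ≤ T) (hg : ContinuousOn g (Icc s T))
    (h₁ : g s ≤ r₁) (h₁₂ : r₁ < r₂) (h₂ : r₂ ≤ g T) :
    ∃ a b, s ≤ a ∧ a < b ∧ b ≤ T ∧ g a = r₁ ∧ g b = r₂ ∧ ∀ t ∈ Ioo a b, r₁ < g t ∧ g t < r₂ := by
  obtain ⟨b, ⟨hb, hb2⟩, hbmin⟩ : ∃ b, IsLeast (Icc s T ∩ g ⁻¹' Ici r₂) b :=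
    (isCompact_Icc.of_isClosed_subset
      (hg.preimage_isClosed_of_isClosed isClosed_Icc isClosed_Ici) inter_subset_left).exists_isLeast
      ⟨T, right_mem_Icc.2 hsT, h₂⟩
  have hgb : g b = r₂ := by
    obtain ⟨t, ht, htr⟩ := intermediate_value_Icc hb.1 (hg.mono (Icc_subset_Icc_right hb.2))
      ⟨h₁.trans h₁₂.le, hb2⟩
    have := hbmin ⟨⟨ht.1, ht.2.trans hb.2⟩, htr.ge⟩
    rwa [le_antisymm ht.2 this] at htr
  have hg' : ContinuousOn g (Icc s b) := hg.mono (Icc_subset_Icc_right hb.2)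
  obtain ⟨a, ⟨ha, ha1⟩, hamax⟩ : ∃ a, IsGreatest (Icc s b ∩ g ⁻¹' Iic r₁) a :=
    (isCompact_Icc.of_isClosed_subset
      (hg'.preimage_isClosed_of_isClosed isClosed_Icc isClosed_Iic)
      inter_subset_left).exists_isGreatest ⟨s, left_mem_Icc.2 hb.1, h₁⟩
  have hga : g a = r₁ := by
    obtain ⟨t, ht, htr⟩ := intermediate_value_Icc ha.2 (hg'.mono (Icc_subset_Icc_left ha.1))
      ⟨ha1, hgb ▸ h₁₂.le⟩
    have := hamax ⟨⟨ha.1.trans ht.1, ht.2⟩, htr.le⟩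
    rwa [le_antisymm this ht.1] at htr
  refine ⟨a, b, ha.1, lt_of_le_of_ne ha.2 fun h => ?_, hb.2, hga, hgb, fun t ht => ⟨?_, ?_⟩⟩
  · rw [h, hgb] at hga
    exact h₁₂.ne' hga
  · by_contra! h
    exact absurd (hamax ⟨⟨ha.1.trans ht.1.le, ht.2.le⟩, h⟩) (not_le.2 ht.1)
  · by_contra! h
    exact absurd (hbmin ⟨⟨ha.1.trans ht.1.le, ht.2.le.trans hb.2⟩, h⟩) (not_le.2 ht.2)

/-- A path leaving `D` from a point mapped to the ball of radius `r₁` has a subpath whose image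
crosses the ring `A(y₀, r₁, r₂)`, if the ball of radius `r₂` lies in the image of `f`. -/
theorem exists_subpath_mem_liftedRingPaths {n : ℕ} (hn : 1 ≤ n) {D : Set (Rn n)} {f : Rn n → Rn n}
    (hD : IsOpen D) (hf : ContinuousOn f D) (hopen : OpenMapOn D f) (hclosed : ClosedMapOn D f)
    {γ : ℝ → Rn n} {s T : ℝ} (hsT : s ≤ T) (hγ : ContinuousOn γ (Icc s T)) (hγ0 : γ s ∈ D)
    (hγ2 : γ T ∉ D) {y₀ : Rn n} {r₁ r₂ : ℝ} (h₁₂ : r₁ < r₂)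
    (hball : Metric.closedBall y₀ r₂ ⊆ f '' D) (hstart : dist (f (γ s)) y₀ ≤ r₁) :
    ∃ p ∈ liftedRingPaths D f y₀ r₁ r₂, p.toFun = γ ∧ Icc p.a p.b ⊆ Icc s T := by
  obtain ⟨T', ⟨hT', hT'D⟩, hmin⟩ : ∃ T', IsLeast (Icc s T ∩ γ ⁻¹' Dᶜ) T' :=
    (isCompact_Icc.of_isClosed_subset
      (hγ.preimage_isClosed_of_isClosed isClosed_Icc hD.isClosed_compl)
      inter_subset_left).exists_isLeast ⟨T, right_mem_Icc.2 hsT, hγ2⟩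
  have hlt : s < T' := lt_of_le_of_ne hT'.1 fun h => hT'D (h ▸ hγ0)
  have hin : ∀ t ∈ Ico s T', γ t ∈ D := by
    intro t ht
    by_contra hcon
    exact absurd (hmin ⟨⟨ht.1, ht.2.le.trans hT'.2⟩, hcon⟩) (not_le.2 ht.2)
  -- Otherwise the path would stay in the compact preimage of the closed ball up to its first exit
  -- time `T'`, forcing `γ T' ∈ D`.
  obtain ⟨t₁, ht₁, hfar⟩ : ∃ t ∈ Ico s T', r₂ ≤ dist (f (γ t)) y₀ := by
    by_contra! hcon
    have hcomp := isCompact_inter_preimage hn hD hf hopen hclosed (isCompact_closedBall y₀ r₂) hball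
    have hmaps : MapsTo γ (Ico s T') (D ∩ f ⁻¹' Metric.closedBall y₀ r₂) :=
      fun t ht => ⟨hin t ht, (hcon t ht).le⟩
    have hcw : ContinuousWithinAt γ (Ico s T') T' :=
      (hγ T' hT').mono (Ico_subset_Icc_self.trans (Icc_subset_Icc_right hT'.2))
    have hcl : T' ∈ closure (Ico s T') := by
      rw [closure_Ico hlt.ne]
      exact right_mem_Icc.2 hlt.le
    have := hcw.mem_closure hcl hmaps
    rw [hcomp.isClosed.closure_eq] at this
    exact hT'D this.1
  have hsub : Icc s t₁ ⊆ Icc s T := Icc_subset_Icc_right (ht₁.2.le.trans hT'.2)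
  have hmapsD : MapsTo γ (Icc s t₁) D := fun t ht => hin t ⟨ht.1, ht.2.trans_lt ht₁.2⟩
  have hg : ContinuousOn (fun t => dist (f (γ t)) y₀) (Icc s t₁) :=
    (continuous_id.dist continuous_const).comp_continuousOn (hf.comp (hγ.mono hsub) hmapsD)
  obtain ⟨a, b, hsa, hab, hbt, hga, hgb, hring⟩ := exists_crossing ht₁.1 hg hstart h₁₂ hfar
  have hsub' : Icc a b ⊆ Icc s t₁ := Icc_subset_Icc hsa hbt
  exact ⟨⟨a, b, hab, γ, hγ.mono (hsub'.trans hsub)⟩,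
    ⟨fun t ht => hmapsD (hsub' ht), hga, hgb, hring⟩, rfl, hsub'.trans hsub⟩

/-! ### Spheres meeting the complement of `D`. -/

theorem isOpen_toExt {n : ℕ} {D : Set (Rn n)} (hD : IsOpen D) : IsOpen (toExt D) :=
  OnePoint.isOpen_image_coe.2 hD

theorem coe_mem_toExt {n : ℕ} {D : Set (Rn n)} {x : Rn n} : (x : RnExt n) ∈ toExt D ↔ x ∈ D :=
  OnePoint.coe_injective.mem_set_image

/-- A connected part of the boundary with points inside and outside the sphere `S(x₀, r)` meets
this sphere. -/
theorem exists_mem_sphere_notMem {n : ℕ} {D : Set (Rn n)} (hD : IsOpen D) {K : Set (RnExt n)}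
    (hK : IsPreconnected K) (hKD : K ⊆ extBoundary D) {x₀ : Rn n} {r : ℝ} {p q : RnExt n}
    (hp : p ∈ K) (hq : q ∈ K) (hpr : p ∈ toExt (Metric.ball x₀ r))
    (hqr : q ∉ toExt (Metric.closedBall x₀ r)) : ∃ k ∈ Metric.sphere x₀ r, k ∉ D := by
  by_contra! hcon
  have hout : IsOpen (toExt (Metric.closedBall x₀ r))ᶜ :=
    OnePoint.isOpen_compl_image_coe.2 ⟨Metric.isClosed_closedBall, isCompact_closedBall _ _⟩
  have hcover : K ⊆ toExt (Metric.ball x₀ r) ∪ (toExt (Metric.closedBall x₀ r))ᶜ := by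
    intro z hz
    by_contra hz'
    simp only [mem_union, mem_compl_iff, not_or, not_not] at hz'
    obtain ⟨hz1, k, hk, rfl⟩ := hz'
    have hks : k ∈ Metric.sphere x₀ r := by
      rw [Metric.mem_sphere]
      refine le_antisymm hk (not_lt.1 fun h => hz1 (coe_mem_toExt.2 h))
    have h1 : (k : RnExt n) ∈ frontier (toExt D) := hKD hz
    rw [(isOpen_toExt hD).frontier_eq] at h1
    exact h1.2 (coe_mem_toExt.2 (hcon k hks))
  obtain ⟨z, -, ⟨w, hw, rfl⟩, hz2⟩ := hK _ _ (isOpen_toExt Metric.isOpen_ball) hout hcover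
    ⟨p, hp, hpr⟩ ⟨q, hq, hqr⟩
  exact hz2 (coe_mem_toExt.2 (Metric.ball_subset_closedBall hw))

theorem BoundaryNondegenerate.exists_ne {n : ℕ} {D : Set (Rn n)} (h : BoundaryNondegenerate D)
    {x : RnExt n} (hx : x ∈ extBoundary D) :
    ∃ y ∈ connectedComponentIn (extBoundary D) x, y ≠ x := by
  by_contra! hcon
  refine h x hx (Subset.antisymm hcon ?_)
  exact singleton_subset_iff.2 (mem_connectedComponentIn hx)

/-- Small spheres about a finite boundary point are not contained in the domain. -/
theorem BoundaryNondegenerate.exists_sphere_notMem {n : ℕ} {D : Set (Rn n)} (hD : IsOpen D)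
    (h : BoundaryNondegenerate D) {x₀ : Rn n} (hx : (x₀ : RnExt n) ∈ extBoundary D) :
    ∃ R > 0, ∀ r, 0 < r → r < R → ∃ k ∈ Metric.sphere x₀ r, k ∉ D := by
  obtain ⟨y, hy, hne⟩ := h.exists_ne hx
  obtain ⟨R, hR, hRy⟩ : ∃ R > 0, ∀ r < R, y ∉ toExt (Metric.closedBall x₀ r) := by
    induction y using OnePoint.rec with
    | infty => exact ⟨1, one_pos, fun r _ => OnePoint.infty_notMem_image_coe⟩
    | coe y =>
      refine ⟨dist y x₀, dist_pos.2 fun h => hne (by rw [h]), fun r hr hmem => ?_⟩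
      exact absurd (coe_mem_toExt.1 hmem) (by simpa using hr)
  exact ⟨R, hR, fun r hr0 hr => exists_mem_sphere_notMem hD isPreconnected_connectedComponentIn
    (connectedComponentIn_subset _ _) (mem_connectedComponentIn hx) hy
    (coe_mem_toExt.2 (Metric.mem_ball_self hr0)) (hRy r hr)⟩

/-- If `∞` is a boundary point, large spheres are not contained in the domain. -/
theorem BoundaryNondegenerate.exists_large_sphere_notMem {n : ℕ} {D : Set (Rn n)} (hD : IsOpen D)
    (h : BoundaryNondegenerate D) (hx : (OnePoint.infty : RnExt n) ∈ extBoundary D) :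
    ∃ R > 0, ∀ r, R < r → ∃ k ∈ Metric.sphere (0 : Rn n) r, k ∉ D := by
  obtain ⟨y, hy, hne⟩ := h.exists_ne hx
  obtain ⟨y, rfl⟩ := OnePoint.ne_infty_iff_exists.1 hne
  refine ⟨‖y‖ + 1, by positivity, fun r hr => ?_⟩
  exact exists_mem_sphere_notMem hD isPreconnected_connectedComponentIn
    (connectedComponentIn_subset _ _) hy (mem_connectedComponentIn hx)
    (coe_mem_toExt.2 (by rw [mem_ball_zero_iff]; linarith)) OnePoint.infty_notMem_image_coe

/-! ### Modulus bounds. -/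

/-- In a domain every compact set lies in a compact connected set containing a given point. -/
theorem exists_isCompact_isPreconnected_superset {n : ℕ} {D : Set (Rn n)} (hD : IsDom D)
    {K : Set (Rn n)} (hK : IsCompact K) (hKD : K ⊆ D) {e : Rn n} (he : e ∈ D) :
    ∃ F, IsCompact F ∧ IsPreconnected F ∧ F ⊆ D ∧ e ∈ F ∧ K ⊆ F := by
  refine hK.induction_on (p := fun s => ∃ F, IsCompact F ∧ IsPreconnected F ∧ F ⊆ D ∧ e ∈ F ∧ s ⊆ F)
    ?_ ?_ ?_ ?_
  · exact ⟨{e}, isCompact_singleton, isPreconnected_singleton, singleton_subset_iff.2 he,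
      mem_singleton e, empty_subset _⟩
  · rintro s t hst ⟨F, h1, h2, h3, h4, h5⟩
    exact ⟨F, h1, h2, h3, h4, hst.trans h5⟩
  · rintro s t ⟨F, h1, h2, h3, h4, h5⟩ ⟨F', h1', h2', h3', h4', h5'⟩
    exact ⟨F ∪ F', h1.union h1', h2.union e h4 h4' h2', union_subset h3 h3', Or.inl h4,
      union_subset_union h5 h5'⟩
  · intro y hy
    obtain ⟨ε, hε, hball⟩ := Metric.nhds_basis_closedBall.mem_iff.1 (hD.1.mem_nhds (hKD hy))
    have hpc : IsPathConnected D := (hD.1.isConnected_iff_isPathConnected).1 hD.2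
    obtain ⟨γ, hγ⟩ := hpc.joinedIn e he y (hKD hy)
    refine ⟨Metric.closedBall y ε, mem_nhdsWithin_of_mem_nhds (Metric.closedBall_mem_nhds y hε),
      range γ ∪ Metric.closedBall y ε, (isCompact_range γ.continuous).union
      (isCompact_closedBall y ε), ?_, union_subset (range_subset_iff.2 hγ) hball,
      Or.inl ⟨0, γ.source⟩, subset_union_right⟩
    exact (isPreconnected_range γ.continuous).union y ⟨1, γ.target⟩
      (Metric.mem_closedBall_self hε.le) (convex_closedBall y ε).isPreconnected

/-- If on all spheres `S(x₀, r)`, `a < r < b`, there are both points outside `D` and points of `D`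
mapped into a set covered by balls `B(y i, r i)`, then `log (b / a)` is controlled by the moduli of
the families of lifts of paths crossing the rings `A(y i, r i, 2 r i)`. -/
theorem exists_modulus_bound {n : ℕ} (hn : 2 ≤ n) : ∃ C : ℝ≥0∞, C ≠ 0 ∧
    ∀ {D : Set (Rn n)} {f : Rn n → Rn n}, IsOpen D → ContinuousOn f D → OpenMapOn D f →
      ClosedMapOn D f → ∀ {ι : Type} [Fintype ι] (y : ι → Rn n) (r : ι → ℝ) (M : ι → ℝ≥0∞),
      (∀ i, 0 < r i) → (∀ i, Metric.closedBall (y i) (2 * r i) ⊆ f '' D) →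
      (∀ i, modulus (liftedRingPaths D f (y i) (r i) (2 * r i)) < M i) →
      ∀ {F : Set (Rn n)}, F ⊆ ⋃ i, Metric.closedBall (y i) (r i) →
      ∀ (x₀ : Rn n) (a b : ℝ), 0 < a → a < b →
      (∀ s ∈ Ioo a b, ∃ c ∈ Metric.sphere x₀ s, c ∈ D ∧ f c ∈ F) →
      (∀ s ∈ Ioo a b, ∃ k ∈ Metric.sphere x₀ s, k ∉ D) →
      C * ENNReal.ofReal (Real.log (b / a)) ≤ ∑ i, M i := by
  obtain ⟨C, hC, hbound⟩ := exists_energy_bound hn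
  refine ⟨C, hC, ?_⟩
  intro D f hD hf hopen hclosed ι _ y r M hr hball hM F hF x₀ a b ha hab hmeet hout
  have hρ : ∀ i, ∃ ρ : Rn n → ℝ≥0∞, Admissible (liftedRingPaths D f (y i) (r i) (2 * r i)) ρ ∧
      ∫⁻ x, ρ x ^ n < M i := by
    intro i
    have := hM i
    simp only [modulus, iInf_lt_iff] at this
    obtain ⟨ρ, h1, h2⟩ := this
    exact ⟨ρ, h1, h2⟩
  choose ρ hadm hintegral using hρ
  have hne : n ≠ 0 := by omega
  calc C * ENNReal.ofReal (Real.log (b / a)) ≤ ∫⁻ x, (⨆ i, ρ i x) ^ n := by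
        refine hbound (fun x => ⨆ i, ρ i x) x₀ a b (.iSup fun i => (hadm i).1) ha hab
          fun s hs => ?_
        obtain ⟨c, hc, hcD, hcF⟩ := hmeet s hs
        obtain ⟨k, hk, hkD⟩ := hout s hs
        refine ⟨c, hc, k, hk, fun γ L hL h0 h2 => ?_⟩
        -- The ball containing `f c` selects the family whose density is used along `γ`.
        obtain ⟨i, hi⟩ := mem_iUnion.1 (hF hcF)
        obtain ⟨p, hp, hpγ, hpsub⟩ := exists_subpath_mem_liftedRingPaths (by omega) hD hf hopen
          hclosed zero_le_two hL.continuousOn (h0 ▸ hcD) (h2 ▸ hkD)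
          (by linarith [hr i] : r i < 2 * r i) (hball i) (h0 ▸ hi)
        have hLp : LipschitzOnWith L p.toFun (Icc p.a p.b) := hpγ ▸ hL.mono hpsub
        have hrect : p.Rectifiable := by
          have := hLp.locallyBoundedVariationOn p.a p.b (left_mem_Icc.2 p.lt.le)
            (right_mem_Icc.2 p.lt.le)
          rwa [inter_self] at this
        calc 1 ≤ p.lineIntegral (ρ i) := (hadm i).2 p hp hrect
          _ ≤ L * ∫⁻ t in Icc p.a p.b, ρ i (p.toFun t) :=
            p.lineIntegral_le_of_lipschitzOnWith hLp (ρ i)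
          _ ≤ L * ∫⁻ t in Icc (0 : ℝ) 2, ⨆ i, ρ i (γ t) := by
            rw [hpγ]
            refine mul_le_mul_right ((lintegral_mono_set hpsub).trans ?_) _
            exact lintegral_mono fun t => le_iSup (fun i => ρ i (γ t)) i
    _ ≤ ∫⁻ x, ∑ i, ρ i x ^ n := by
        refine lintegral_mono fun x => ?_
        cases isEmpty_or_nonempty ι
        · simp [hne]
        · obtain ⟨i, hi⟩ := exists_eq_ciSup_of_finite (f := fun i => ρ i x)
          rw [← hi]
          exact Finset.single_le_sum (f := fun i => ρ i x ^ n) (fun _ _ => zero_le)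
            (Finset.mem_univ i)
    _ = ∑ i, ∫⁻ x, ρ i x ^ n := lintegral_finsetSum _ fun i _ => (hadm i).1.pow_const n
    _ ≤ ∑ i, M i := Finset.sum_le_sum fun i _ => (hintegral i).le

theorem ofReal_lt_iSup_edist {n : ℕ} (hn : 1 ≤ n) {S : Set (Rn n)} {y : Rn n} {s t : ℝ}
    (hs : 0 < s) (hts : t < s) (h : Metric.closedBall y s ⊆ S) :
    ENNReal.ofReal t < ⨆ z ∈ S, edist z y := by
  have : NeZero n := ⟨by omega⟩
  obtain ⟨v, hv⟩ := exists_norm_eq (Rn n) hs.le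
  have h1 : dist (y + v) y = s := by simp [hv]
  calc ENNReal.ofReal t < ENNReal.ofReal s := (ENNReal.ofReal_lt_ofReal_iff hs).2 hts
    _ = edist (y + v) y := by rw [edist_dist, h1]
    _ ≤ _ := le_iSup₂ (f := fun z (_ : z ∈ S) => edist z y) (y + v) (h h1.le)

/-- The preimage of a connected set containing a point of `E` meets all spheres separating one of
its points from `f ⁻¹ E`. -/
theorem exists_mem_sphere_of_mem_ball {n : ℕ} {D E F : Set (Rn n)} {f : Rn n → Rn n}
    (hD : IsOpen D) (hopen : OpenMapOn D f) (hclosed : ClosedMapOn D f) (hF : IsPreconnected F)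
    (hFD : F ⊆ f '' D) (hEF : (E ∩ F).Nonempty) {x₀ x : Rn n} {s : ℝ} (hs : 0 < s)
    (hE : ∀ z ∈ Metric.ball x₀ s, z ∈ D → f z ∉ E) (hx : x ∈ D) (hxs : x ∈ Metric.ball x₀ s)
    (hxF : f x ∈ F) : ∃ c ∈ Metric.sphere x₀ s, c ∈ D ∧ f c ∈ F := by
  by_contra! hcon
  obtain ⟨e, heE, heF⟩ := hEF
  obtain ⟨z, ⟨hzD, hzs⟩, rfl⟩ := subset_image_inter_of_isPreconnected hD hopen hclosed hF hFD
    Metric.isOpen_ball (V := Metric.ball x₀ s)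
    (fun w hw hwF hfr => hcon w (frontier_ball x₀ hs.ne' ▸ hfr) hw hwF) hx hxs hxF heF
  exact hE z hzs hzD heE

/-- The counterpart for exteriors of balls, needed at the boundary point `∞`. -/
theorem exists_mem_sphere_of_notMem_closedBall {n : ℕ} {D E F : Set (Rn n)} {f : Rn n → Rn n}
    (hD : IsOpen D) (hopen : OpenMapOn D f) (hclosed : ClosedMapOn D f) (hF : IsPreconnected F)
    (hFD : F ⊆ f '' D) (hEF : (E ∩ F).Nonempty) {x₀ x : Rn n} {s : ℝ} (hs : 0 < s)
    (hE : ∀ z ∉ Metric.closedBall x₀ s, z ∈ D → f z ∉ E) (hx : x ∈ D)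
    (hxs : x ∉ Metric.closedBall x₀ s) (hxF : f x ∈ F) :
    ∃ c ∈ Metric.sphere x₀ s, c ∈ D ∧ f c ∈ F := by
  by_contra! hcon
  obtain ⟨e, heE, heF⟩ := hEF
  obtain ⟨z, ⟨hzD, hzs⟩, rfl⟩ := subset_image_inter_of_isPreconnected hD hopen hclosed hF hFD
    Metric.isClosed_closedBall.isOpen_compl (V := (Metric.closedBall x₀ s)ᶜ)
    (fun w hw hwF hfr => hcon w
      (by rwa [frontier_compl, frontier_closedBall x₀ hs.ne'] at hfr) hw hwF) hx hxs hxF heF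
  exact hE z hzs hzD heE

/-- Compact subsets of `D₀` have finite covers by balls for which the moduli of the ring families
are bounded uniformly over the class of mappings whose images contain a compact subset of `D₀`. -/
theorem exists_cover_modulus_lt {n : ℕ} (hn : 2 ≤ n) {D₀ : Set (Rn n)} (hD₀ : IsOpen D₀)
    {Q : Rn n → ℝ≥0∞} (hQ : AEMeasurable Q volume) (hQint : IntegrableOnManySpheres Q D₀)
    {F : Set (Rn n)} (hF : IsCompact F) (hFD₀ : F ⊆ D₀) :
    ∃ (t : Finset (Rn n)) (r : Rn n → ℝ) (M : Rn n → ℝ≥0∞) (K : Set (Rn n)),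
      (∀ y ∈ t, 0 < r y) ∧ (∀ y ∈ t, M y ≠ ∞) ∧ IsCompact K ∧ K ⊆ D₀ ∧
      F ⊆ ⋃ y ∈ t, Metric.closedBall y (r y) ∧ (∀ y ∈ t, Metric.closedBall y (2 * r y) ⊆ K) ∧
      ∀ (D : Set (Rn n)) (f : Rn n → Rn n), (∀ y ∈ closure D₀, InversePoletskyAt D Q f y) →
        K ⊆ f '' D → ∀ y ∈ t, modulus (liftedRingPaths D f y (r y) (2 * r y)) < M y := by
  -- The factor `3` leaves room for the strict inequality `2r < sup |z - y|` required by both the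
  -- Poletsky and the integrability hypotheses.
  have hchoice : ∀ y : Rn n, ∃ r : ℝ, 0 < r ∧ (y ∈ F → Metric.closedBall y (3 * r) ⊆ D₀) := by
    intro y
    by_cases hy : y ∈ F
    · obtain ⟨ε, hε, hball⟩ := Metric.nhds_basis_closedBall.mem_iff.1 (hD₀.mem_nhds (hFD₀ hy))
      exact ⟨ε / 3, by positivity, fun _ => by rwa [mul_div_cancel₀ ε three_ne_zero]⟩
    · exact ⟨1, one_pos, fun h => absurd h hy⟩
  choose r hr hball using hchoice
  have hweight : ∀ y : Rn n, ∃ η : ℝ → ℝ≥0∞, y ∈ F → Measurable η ∧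
      1 ≤ ∫⁻ s in Ioo (r y) (2 * r y), η s ∧
      ∫⁻ z in sphericalRing y (r y) (2 * r y), Q z * η (dist z y) ^ n < ∞ := by
    intro y
    by_cases hy : y ∈ F
    · obtain ⟨η, hη⟩ := exists_weight hn hQ hQint (subset_closure (hFD₀ hy)) (hr y)
        (by linarith [hr y] : r y < 2 * r y)
        (ofReal_lt_iSup_edist (by omega) (by linarith [hr y]) (by linarith [hr y]) (hball y hy))
      exact ⟨η, fun _ => hη⟩
    · exact ⟨0, fun h => absurd h hy⟩
  choose η hη using hweight
  obtain ⟨t, htF, hcover⟩ := hF.elim_nhds_subcover (fun y => Metric.closedBall y (r y))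
    fun y _ => Metric.closedBall_mem_nhds y (hr y)
  refine ⟨t, r, fun y => (∫⁻ z in sphericalRing y (r y) (2 * r y), Q z * η y (dist z y) ^ n) + 1,
    ⋃ y ∈ t, Metric.closedBall y (3 * r y), fun y _ => hr y, fun y hy => ?_,
    t.finite_toSet.isCompact_biUnion fun y _ => isCompact_closedBall _ _,
    iUnion₂_subset fun y hy => hball y (htF y hy), hcover, fun y hy => ?_, ?_⟩
  · exact ENNReal.add_ne_top.2 ⟨(hη y (htF y hy)).2.2.ne, ENNReal.one_ne_top⟩
  · exact (Metric.closedBall_subset_closedBall (by linarith [hr y])).trans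
      (subset_biUnion_of_mem (u := fun y => Metric.closedBall y (3 * r y)) hy)
  · intro D f hpol hK y hy
    obtain ⟨hηm, hη1, hηint⟩ := hη y (htF y hy)
    have hsub : Metric.closedBall y (3 * r y) ⊆ f '' D :=
      (subset_biUnion_of_mem (u := fun y => Metric.closedBall y (3 * r y)) hy).trans hK
    refine lt_of_le_of_lt ?_ (ENNReal.lt_add_right hηint.ne one_ne_zero)
    refine (hpol y (subset_closure (hFD₀ (htF y hy))) (r y) (2 * r y) (hr y) (by linarith [hr y])
      (ofReal_lt_iSup_edist (by omega) (by linarith [hr y]) (by linarith [hr y]) hsub)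
      (η y) hηm.aemeasurable hη1).trans (lintegral_mono_set inter_subset_left)

end InversePoletsky

/-! ### The main theorem. -/

theorem lemma3p1 (n : ℕ) (hn : 2 ≤ n) (δ : ℝ) (hδ : 0 < δ)
    (D D₀ : Set (Rn n)) (hD : IsDom D) (hD₀ : IsDom D₀)
    (E : Set (Rn n)) (hEcompact : IsCompact E) (hEne : E.Nonempty) (hED₀ : E ⊆ D₀)
    (Q : Rn n → ℝ≥0∞) (hQmeas : AEMeasurable Q volume) (hQ0 : ∀ y ∉ D₀, Q y = 0)
    (hbdry : BoundaryNondegenerate D)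
    (f : ℕ → Rn n → Rn n) (hf : ∀ m, MemClass E Q δ D D₀ (f m))
    (A₀ : Rn n) (hker : ConvergesToKernel (fun m => f m '' D) A₀ D₀)
    (hQint : IntegrableOnManySpheres Q D₀)
    (Estar : Set (Rn n)) (hEstar : IsCompact Estar) (hEstarD₀ : Estar ⊆ D₀)
    (hEstar_image : ∀ m, Estar ⊆ f m '' D) :
    ∃ δstar : ℝ, 0 < δstar ∧
      ∀ m, ENNReal.ofReal δstar ≤
        chordalDist (toExt (D ∩ f m ⁻¹' Estar)) (extBoundary D) := by
  obtain ⟨e, he⟩ := hEne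
  obtain ⟨F, hFc, hFconn, hFD₀, heF, hEF⟩ :=
    exists_isCompact_isPreconnected_superset hD₀ hEstar hEstarD₀ (hED₀ he)
  obtain ⟨t, r, M, K, hr, hM, hKc, hKD₀, hcover, hball, hmod⟩ :=
    exists_cover_modulus_lt hn hD₀.1 hQmeas hQint hFc hFD₀
  obtain ⟨N, hN⟩ := (hker id strictMono_id).2.1.2.2 (K ∪ F) (union_subset hKD₀ hFD₀)
    (hKc.union hFc)
  obtain ⟨C, hC, hbound⟩ := exists_modulus_bound hn
  set S := ∑ y : t, M y with hS
  have hStop : S ≠ ∞ := ENNReal.sum_ne_top.2 fun (y : t) _ => hM y y.2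
  -- Chosen so that `C * l > S`; a ring with radius ratio `exp l` then violates the modulus bound.
  set l : ℝ := (S / C).toReal + 1 with hl
  have hl0 : 0 < l := by positivity
  have hlS : S < C * ENNReal.ofReal l := by
    have h1 : S / C ≠ ∞ := ENNReal.div_ne_top hStop hC
    rw [mul_comm, ← ENNReal.div_lt_iff (Or.inl hC) (Or.inr hStop), hl,
      ENNReal.ofReal_add ENNReal.toReal_nonneg zero_le_one, ENNReal.ofReal_toReal h1,
      ENNReal.ofReal_one]
    exact ENNReal.lt_add_right h1 one_ne_zero
  have hcontra : ∀ m ≥ N, ∀ (x₀ : Rn n) (a : ℝ), 0 < a →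
      (∀ s ∈ Ioo a (a * Real.exp l), ∃ c ∈ Metric.sphere x₀ s, c ∈ D ∧ f m c ∈ F) →
      (∀ s ∈ Ioo a (a * Real.exp l), ∃ k ∈ Metric.sphere x₀ s, k ∉ D) → False := by
    intro m hm x₀ a ha hmeet hout
    have hKm : K ⊆ f m '' D := subset_union_left.trans (hN m hm)
    have h1 := hbound hD.1 (hf m).continuousOn (hf m).openMap (hf m).closedMap
      (fun y : t => (y : Rn n)) (fun y => r y) (fun y => M y) (fun y => hr y y.2)
      (fun y => (hball y y.2).trans hKm) (fun y => hmod D (f m) (hf m).poletsky hKm y y.2)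
      (F := F) (by rwa [iUnion_subtype (· ∈ t) fun y => Metric.closedBall (y : Rn n) (r y)])
      x₀ a (a * Real.exp l) ha
      (lt_mul_of_one_lt_right ha (Real.one_lt_exp_iff.2 hl0)) hmeet hout
    rw [mul_div_cancel_left₀ _ ha.ne', Real.log_exp] at h1
    exact absurd h1 (not_le.2 hlS)
  -- It suffices that the closure of this union misses the boundary: in the compact extended space
  -- this gives a positive distance valid for all `m ≥ N`.
  set B := ⋃ m ≥ N, toExt (D ∩ f m ⁻¹' Estar) with hB
  have hlocal : ∀ b ∈ extBoundary D, b ∉ closure B := by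
    intro b hb
    have hev := eventually_notMem_of_le_chordalDist hb hδ
    have hsuff : (∃ U ∈ 𝓝 b, ∀ m ≥ N, ∀ x ∈ D, f m x ∈ Estar → (x : RnExt n) ∉ U) →
        b ∉ closure B := by
      rintro ⟨U, hU, hUB⟩ hcl
      obtain ⟨z, hzU, hzB⟩ := mem_closure_iff_nhds.1 hcl U hU
      simp only [hB, mem_iUnion] at hzB
      obtain ⟨m, hm, x, ⟨hxD, hxE⟩, rfl⟩ := hzB
      exact hUB m hm x hxD hxE hzU
    refine hsuff ?_
    induction b using OnePoint.rec with
    | infty =>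
      obtain ⟨R₂, hR₂, hout⟩ := hbdry.exists_large_sphere_notMem hD.1 hb
      have hev' := OnePoint.tendsto_coe_infty.eventually hev
      rw [coclosedCompact_eq_cocompact] at hev'
      obtain ⟨K', hK', hK'sub⟩ := mem_cocompact.1 hev'
      obtain ⟨R₁, hR₁⟩ := hK'.isBounded.subset_closedBall (0 : Rn n)
      -- Beyond `R₁` there are no preimages of `E`; spheres of radius beyond `R₂` leave `D`.
      set a := max R₁ R₂ with ha
      have ha0 : 0 < a := lt_max_of_lt_right hR₂
      refine ⟨(toExt (Metric.closedBall 0 (a * Real.exp l)))ᶜ, ?_, ?_⟩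
      · exact (OnePoint.isOpen_compl_image_coe.2 ⟨Metric.isClosed_closedBall,
          isCompact_closedBall _ _⟩).mem_nhds OnePoint.infty_notMem_image_coe
      · intro m hm x hxD hxE hxU
        refine hcontra m hm 0 a ha0 (fun s hs => ?_)
          fun s hs => hout s ((le_max_right _ _).trans_lt hs.1)
        refine exists_mem_sphere_of_notMem_closedBall hD.1 (hf m).openMap (hf m).closedMap hFconn
          (subset_union_right.trans (hN m hm)) ⟨e, he, heF⟩ (ha0.trans hs.1) (fun z hz hzD hzE => ?_)
          hxD (fun hx => hxU (coe_mem_toExt.2 (Metric.closedBall_subset_closedBall hs.2.le hx)))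
          (hEF hxE)
        have hzK : z ∉ K' := fun h => hz (Metric.closedBall_subset_closedBall
          ((le_max_left _ _).trans hs.1.le) (hR₁ h))
        exact hK'sub hzK _ (hf m).dist_preimage (coe_mem_toExt.2 ⟨hzD, hzE⟩)
    | coe x₀ =>
      obtain ⟨R₂, hR₂, hout⟩ := hbdry.exists_sphere_notMem hD.1 hb
      obtain ⟨R₁, hR₁, hsub⟩ := Metric.eventually_nhds_iff_ball.1
        (OnePoint.continuous_coe.continuousAt.eventually hev)
      -- Here `b` becomes a radius: inside `R₁` there are no preimages of `E`, and spheres smaller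
      -- than `R₂` leave `D`. A preimage point within `b * exp (-l)` of `x₀` would give a forbidden
      -- ring of ratio `exp l`.
      set b := min R₁ R₂ with hb'
      have hb0 : 0 < b := lt_min hR₁ hR₂
      have ha0 : 0 < b * Real.exp (-l) := by positivity
      have hab : b * Real.exp (-l) * Real.exp l = b := by
        rw [mul_assoc, ← Real.exp_add, neg_add_cancel, Real.exp_zero, mul_one]
      refine ⟨toExt (Metric.ball x₀ (b * Real.exp (-l))), ?_, ?_⟩
      · exact (isOpen_toExt Metric.isOpen_ball).mem_nhds
          (coe_mem_toExt.2 (Metric.mem_ball_self ha0))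
      · intro m hm x hxD hxE hxU
        refine hcontra m hm x₀ (b * Real.exp (-l)) ha0 (fun s hs => ?_) fun s hs => ?_
        · rw [hab] at hs
          refine exists_mem_sphere_of_mem_ball hD.1 (hf m).openMap (hf m).closedMap hFconn
            (subset_union_right.trans (hN m hm)) ⟨e, he, heF⟩ (ha0.trans hs.1)
            (fun z hz hzD hzE => ?_)
            hxD (Metric.ball_subset_ball hs.1.le (coe_mem_toExt.1 hxU)) (hEF hxE)
          have hzb : z ∈ Metric.ball x₀ R₁ :=
            Metric.ball_subset_ball (hs.2.le.trans (min_le_left _ _)) hz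
          exact hsub z hzb _ (hf m).dist_preimage (coe_mem_toExt.2 ⟨hzD, hzE⟩)
        · rw [hab] at hs
          exact hout s (ha0.trans hs.1) (hs.2.trans_le (min_le_right _ _))
  have hcompact : ∀ m, IsCompact (toExt (D ∩ f m ⁻¹' Estar)) := fun m =>
    (isCompact_inter_preimage (by omega) hD.1 (hf m).continuousOn (hf m).openMap (hf m).closedMap
      hEstar (hEstar_image m)).image OnePoint.continuous_coe
  obtain ⟨δ', hδ', hle⟩ := exists_pos_le_chordalDist
    (K := (⋃ m ∈ Iio N, toExt (D ∩ f m ⁻¹' Estar)) ∪ closure B) (B := extBoundary D)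
    (((finite_Iio N).isCompact_biUnion fun m _ => hcompact m).union isClosed_closure.isCompact)
    isClosed_frontier.isCompact (by
      refine disjoint_right.2 fun b hb => ?_
      rintro (h | h)
      · simp only [mem_iUnion] at h
        obtain ⟨m, -, x, ⟨hxD, -⟩, rfl⟩ := h
        rw [extBoundary, (isOpen_toExt hD.1).frontier_eq] at hb
        exact hb.2 (coe_mem_toExt.2 hxD)
      · exact hlocal b hb h)
  refine ⟨δ', hδ', fun m => hle.trans (biInf_mono fun x hx => ?_)⟩
  rcases lt_or_ge m N with hm | hm
  · exact Or.inl (mem_iUnion₂.2 ⟨m, hm, hx⟩)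
  · exact Or.inr (subset_closure (mem_iUnion₂.2 ⟨m, hm, hx⟩))
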